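/- Let $n\ge 2$ and $0\le\alpha<\beta\le\infty$. Put $\mathbf z=\sum_{i=1}^n|z_i|^2$ on $\mathbb C^n$, and let $\mathcal A_{\alpha,\beta}=\{\alpha<\mathbf z<\beta\}\subset\mathbb C^n$ with the standard complex structure $J_0$. A Hermitian metric (a smooth Riemannian metric $g$ with $g(J_0\cdot,J_0\cdot)=g$) is Kähler if $d\omega=0$ for $\omega(\cdot,\cdot)=g(J_0\cdot,\cdot)$, and is Klsc (Kähler like scalar curvature) if $S=2S_C$, where $S$ is its Riemannian scalar curvature and $S_C=g^{i\bar j}g^{k\bar\ell}\Theta_{i\bar jk\bar\ell}$ (with $g_{i\bar j}=g(\partial_{z_i},\partial_{\bar z_j})$) is the scalar curvature of its Chern connection. Let $h$ be the metric along the Hopf fibres and $g_{\mathbb{CP}^{n-1}}$ the Fubini–Study metric, pulled back to $\mathbb C^n\setminus\{0\}$ and normalized so that the round unit sphere metric is $g_{S^{2n-1}}=g_{\mathbb{CP}^{n-1}}+h$. For each smooth positive function $\mathscr F$ on $(\alpha,\beta)$ fix an antiderivative $\int\frac{d\mathbf z}{\mathbf z^n\mathscr F^{n-1}}$ on $(\alpha,\beta)$.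 A pair $(\mathscr F,\mathcal C)$ of such a function and a real constant is called admissible if $\int\frac{d\mathbf z}{\mathbf z^n\mathscr F^{n-1}}+\mathcal C$ has no zero on $(\alpha,\beta)$ and $$\mathbf z\mathscr F\cdot\Big(\frac1{2n-1}\Big(\int\frac{d\mathbf z}{\mathbf z^n\mathscr F^{n-1}}+\mathcal C\Big)\Big)^{-2}$$ has positive derivative with respect to $\mathbf z$ on $(\alpha,\beta)$. For every admissible pair $(\mathscr F,\mathcal C)$, $$g_{(\mathscr F,\mathcal C)}=\Bigg((\mathbf z\mathscr F)'-\frac{2}{\mathbf z^{n-1}\mathscr F^{n-2}}\Big(\int\frac{d\mathbf z}{\mathbf z^n\mathscr F^{n-1}}+\mathcal C\Big)^{-1}\Bigg)\Big((d\sqrt{\mathbf z})^2+\mathbf z\,h\Big)+\mathbf z\mathscr F\cdot g_{\mathbb{CP}^{n-1}}$$ is a $U(n)$-invariant non-Kähler Hermitian Klsc metric on $\mathcal A_{\alpha,\beta}$. Conversely, every $U(n)$-invariant non-Kähler Hermitian Klsc metric on $\mathcal A_{\alpha,\beta}$ equals $g_{(\mathscr F,\mathcal C)}$ for exactly one admissible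 pair $(\mathscr F,\mathcal C)$. Thus the moduli space of such metrics is in bijection with the space of admissible pairs. -/

import Mathlib

open scoped ContDiff

noncomputable section

namespace Klsc

/-- `ℂⁿ` with its Euclidean norm; multiplication by `Complex.I` is the standard complex
structure `J₀`. -/
abbrev Cn (n : ℕ) : Type := EuclideanSpace ℂ (Fin n)

/-- Fields of real bilinear forms on `ℂⁿ` (only their values on an annulus matter). -/
abbrev TensorField (n : ℕ) : Type := Cn n → Cn n →L[ℝ] Cn n →L[ℝ] ℝ

/-- The radial variable `𝐳 = ∑ |z_i|²`. -/
def radial {n : ℕ} (p : Cn n) : ℝ := ∑ i, ‖p i‖ ^ 2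

/-- The range `(α, β)` of the radial variable; `β = ⊤` (i.e. `∞`) is allowed. -/
def radialInterval (α : ℝ) (β : EReal) : Set ℝ := {t | α < t ∧ (t : EReal) < β}

/-- The annulus `{p ∈ ℂⁿ : α < 𝐳 < β}`. -/
def annulus (n : ℕ) (α : ℝ) (β : EReal) : Set (Cn n) := {p | radial p ∈ radialInterval α β}

/-! ### Hermitian metrics -/

/-- `g` is a smooth Riemannian metric on `A ⊆ ℂⁿ` that is Hermitian with respect to `J₀`. -/
structure IsHermitianMetricOn {n : ℕ} (A : Set (Cn n)) (g : TensorField n) : Prop where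
  smooth : ContDiffOn ℝ ∞ g A
  symm : ∀ p ∈ A, ∀ v w, g p v w = g p w v
  pos : ∀ p ∈ A, ∀ v, v ≠ 0 → 0 < g p v v
  hermitian : ∀ p ∈ A, ∀ v w, g p (Complex.I • v) (Complex.I • w) = g p v w

/-- Invariance under the unitary group `U(n)`. -/
def IsUnitaryInvariantOn {n : ℕ} (A : Set (Cn n)) (g : TensorField n) : Prop :=
  ∀ U : Cn n ≃ₗᵢ[ℂ] Cn n, ∀ p ∈ A, ∀ v w, g (U p) (U v) (U w) = g p v w

/-- The associated 2-form `ω(v, w) = g(J₀ v, w)`. -/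
def assocForm {n : ℕ} (g : TensorField n) (p : Cn n) (v w : Cn n) : ℝ := g p (Complex.I • v) w

/-- The exterior derivative of the associated 2-form, evaluated on constant vector fields. -/
def dAssocForm {n : ℕ} (g : TensorField n) (p : Cn n) (u v w : Cn n) : ℝ :=
  fderiv ℝ (fun q => assocForm g q v w) p u + fderiv ℝ (fun q => assocForm g q w u) p v
    + fderiv ℝ (fun q => assocForm g q u v) p w

/-- The Kähler condition `dω = 0` on `A`. -/
def IsKahlerOn {n : ℕ} (A : Set (Cn n)) (g : TensorField n) : Prop :=
  ∀ p ∈ A, ∀ u v w, dAssocForm g p u v w = 0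

/-! ### Riemannian scalar curvature, in the real coordinates `x₁, …, xₙ, y₁, …, yₙ` -/

/-- The real coordinate vector fields: `∂/∂x_j` is `inl j`, `∂/∂y_j` is `inr j`. -/
def realBasis (n : ℕ) : Fin n ⊕ Fin n → Cn n
  | Sum.inl j => EuclideanSpace.single j 1
  | Sum.inr j => EuclideanSpace.single j Complex.I

/-- Partial derivative in a real coordinate direction. -/
def realPartial {n : ℕ} (a : Fin n ⊕ Fin n) (f : Cn n → ℝ) (p : Cn n) : ℝ :=
  fderiv ℝ f p (realBasis n a)

/-- `g_{ab}`. -/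
def gram {n : ℕ} (g : TensorField n) (p : Cn n) : Matrix (Fin n ⊕ Fin n) (Fin n ⊕ Fin n) ℝ :=
  Matrix.of fun a b => g p (realBasis n a) (realBasis n b)

/-- Christoffel symbols `Γ^c_{ab} = ½ g^{cd} (∂_a g_{bd} + ∂_b g_{ad} - ∂_d g_{ab})`. -/
def christoffel {n : ℕ} (g : TensorField n) (c a b : Fin n ⊕ Fin n) (p : Cn n) : ℝ :=
  (1 / 2) * ∑ d, (gram g p)⁻¹ c d *
    (realPartial a (fun q => gram g q b d) p + realPartial b (fun q => gram g q a d) p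
      - realPartial d (fun q => gram g q a b) p)

/-- `R^d_{cab}`, where `R(∂_a, ∂_b) ∂_c = R^d_{cab} ∂_d` for the Levi-Civita connection. -/
def riemann {n : ℕ} (g : TensorField n) (d c a b : Fin n ⊕ Fin n) (p : Cn n) : ℝ :=
  realPartial a (christoffel g d b c) p - realPartial b (christoffel g d a c) p
    + ∑ e, (christoffel g d a e p * christoffel g e b c p
      - christoffel g d b e p * christoffel g e a c p)

/-- Ricci curvature `R_{bc} = R^a_{cab}`. -/
def ricci {n : ℕ} (g : TensorField n) (b c : Fin n ⊕ Fin n) (p : Cn n) : ℝ :=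
  ∑ a, riemann g a c a b p

/-- Riemannian scalar curvature `S = g^{bc} R_{bc}`. -/
def scalarCurvature {n : ℕ} (g : TensorField n) (p : Cn n) : ℝ :=
  ∑ b, ∑ c, (gram g p)⁻¹ b c * ricci g b c p

/-! ### Chern scalar curvature, in the complex coordinates `z₁, …, zₙ` -/

/-- The Wirtinger derivative `∂/∂z_i = ½ (∂/∂x_i - √-1 ∂/∂y_i)`. -/
def dz {n : ℕ} (i : Fin n) (f : Cn n → ℂ) (p : Cn n) : ℂ :=
  (1 / 2) * (fderiv ℝ f p (realBasis n (Sum.inl i))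
    - Complex.I * fderiv ℝ f p (realBasis n (Sum.inr i)))

/-- The Wirtinger derivative `∂/∂z̄_i = ½ (∂/∂x_i + √-1 ∂/∂y_i)`. -/
def dzbar {n : ℕ} (i : Fin n) (f : Cn n → ℂ) (p : Cn n) : ℂ :=
  (1 / 2) * (fderiv ℝ f p (realBasis n (Sum.inl i))
    + Complex.I * fderiv ℝ f p (realBasis n (Sum.inr i)))

/-- `g_{i j̄} = g(∂/∂z_i, ∂/∂z̄_j)` for the complex bilinear extension of `g`. -/
def hermMatrix {n : ℕ} (g : TensorField n) (p : Cn n) : Matrix (Fin n) (Fin n) ℂ :=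
  Matrix.of fun i j =>
    (1 / 4) * (((gram g p (Sum.inl i) (Sum.inl j) + gram g p (Sum.inr i) (Sum.inr j) : ℝ) : ℂ)
      + Complex.I *
        ((gram g p (Sum.inl i) (Sum.inr j) - gram g p (Sum.inr i) (Sum.inl j) : ℝ) : ℂ))

/-- `g^{i j̄}`, normalized by `∑_j g_{k j̄} g^{i j̄} = δ_{ki}`. -/
def hermInv {n : ℕ} (g : TensorField n) (p : Cn n) (i j : Fin n) : ℂ := (hermMatrix g p)⁻¹ j i

/-- The coefficients of the Chern connection: `∇_{∂/∂z_i} ∂/∂z_k = ∑_m Γ^m_{ik} ∂/∂z_m` with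
`Γ^m_{ik} = g^{m q̄} ∂_i g_{k q̄}` (and `∇_{∂/∂z̄_i} ∂/∂z_k = 0`). -/
def chernChristoffel {n : ℕ} (g : TensorField n) (m i k : Fin n) (p : Cn n) : ℂ :=
  ∑ q, hermInv g p m q * dz i (fun x => hermMatrix g x k q) p

/-- The curvature `Θ_{i j̄ k l̄} = -g_{m l̄} ∂_{j̄} Γ^m_{ik}` of the Chern connection. -/
def chernCurvature {n : ℕ} (g : TensorField n) (i j k l : Fin n) (p : Cn n) : ℂ :=
  -∑ m, dzbar j (chernChristoffel g m i k) p * hermMatrix g p m l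

/-- Chern scalar curvature `S_C = g^{i j̄} g^{k l̄} Θ_{i j̄ k l̄}`. -/
def chernScalarCurvature {n : ℕ} (g : TensorField n) (p : Cn n) : ℂ :=
  ∑ i, ∑ j, ∑ k, ∑ l, hermInv g p i j * hermInv g p k l * chernCurvature g i j k l p

/-- The Kähler like scalar curvature condition `S = 2 S_C` on `A`. -/
def IsKlscOn {n : ℕ} (A : Set (Cn n)) (g : TensorField n) : Prop :=
  ∀ p ∈ A, (scalarCurvature g p : ℂ) = 2 * chernScalarCurvature g p

/-- `g` is a `U(n)`-invariant non-Kähler Hermitian Klsc metric on the annulus. -/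
structure IsModuliMetric (n : ℕ) (α : ℝ) (β : EReal) (g : TensorField n) : Prop where
  hermitianMetric : IsHermitianMetricOn (annulus n α β) g
  invariant : IsUnitaryInvariantOn (annulus n α β) g
  nonKahler : ¬ IsKahlerOn (annulus n α β) g
  klsc : IsKlscOn (annulus n α β) g

/-! ### The building blocks of `U(n)`-invariant metrics -/

/-- The 1-form `d√𝐳`. -/
def dSqrtRadial {n : ℕ} (p : Cn n) : Cn n →L[ℝ] ℝ := fderiv ℝ (fun q => √(radial q)) p

/-- The symmetric tensor `(d√𝐳)²`. -/
def dSqrtRadialSq (n : ℕ) : TensorField n := fun p => (dSqrtRadial p).smulRight (dSqrtRadial p)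

/-- The 1-form dual to the Hopf fibres, pulled back from `S^{2n-1}` to `ℂⁿ ∖ {0}`:
`v ↦ Im ⟨p, v⟩ / |p|²`; it takes the value `1` on the generator `√-1 p` of the Hopf action. -/
def hopfForm {n : ℕ} (p : Cn n) : Cn n →L[ℝ] ℝ :=
  (radial p)⁻¹ • Complex.imCLM.comp ((innerSL ℂ p).restrictScalars ℝ)

/-- The metric `h` along the Hopf fibres. -/
def hopfMetric (n : ℕ) : TensorField n := fun p => (hopfForm p).smulRight (hopfForm p)

/-- The Euclidean metric of `ℂⁿ = ℝ²ⁿ`. -/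
def euclideanMetric (n : ℕ) : Cn n →L[ℝ] Cn n →L[ℝ] ℝ := innerSL ℝ

/-- The standard metric of `S^{2n-1}`, pulled back to `ℂⁿ ∖ {0}` along `p ↦ p / |p|`:
the Euclidean metric is `(d√𝐳)² + 𝐳 g_{S^{2n-1}}`. -/
def sphereMetric (n : ℕ) : TensorField n :=
  fun p => (radial p)⁻¹ • (euclideanMetric n - dSqrtRadialSq n p)

/-- The Fubini–Study metric of `ℂℙ^{n-1}`, pulled back to `ℂⁿ ∖ {0}`, normalized so that
`g_{S^{2n-1}} = g_{ℂℙ^{n-1}} + h`. -/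
def fubiniStudy (n : ℕ) : TensorField n := fun p => sphereMetric n p - hopfMetric n p

/-! ### Admissible pairs -/

/-- `F` is a smooth positive function of the radial variable. -/
structure IsProfile (α : ℝ) (β : EReal) (F : ℝ → ℝ) : Prop where
  smooth : ContDiffOn ℝ ∞ F (radialInterval α β)
  pos : ∀ t ∈ radialInterval α β, 0 < F t

/-- A choice, for each smooth positive `F` on `(α, β)`, of one antiderivative
`I F = ∫ d𝐳 / (𝐳ⁿ Fⁿ⁻¹)` on `(α, β)`, depending only on the values of `F` on `(α, β)`. -/
structure IsAntiderivativeChoice (n : ℕ) (α : ℝ) (β : EReal) (I : (ℝ → ℝ) → ℝ → ℝ) : Prop where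
  hasDerivAt : ∀ F, IsProfile α β F → ∀ t ∈ radialInterval α β,
    HasDerivAt (I F) (1 / (t ^ n * F t ^ (n - 1))) t
  congr : ∀ F G, IsProfile α β F → IsProfile α β G → Set.EqOn F G (radialInterval α β) →
    Set.EqOn (I F) (I G) (radialInterval α β)

/-- Admissibility of `(F, C)`: the function `𝐳 F · ((∫ d𝐳 / (𝐳ⁿ Fⁿ⁻¹) + C) / (2n-1))⁻²` is defined
on all of `(α, β)` and has positive derivative there. -/
structure IsAdmissible (n : ℕ) (α : ℝ) (β : EReal) (I : (ℝ → ℝ) → ℝ → ℝ) (F : ℝ → ℝ) (C : ℝ) :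
    Prop where
  profile : IsProfile α β F
  ne_zero : ∀ t ∈ radialInterval α β, I F t + C ≠ 0
  increasing : ∀ t ∈ radialInterval α β,
    0 < deriv (fun s => s * F s * (((I F s + C) / (2 * n - 1)) ^ 2)⁻¹) t

/-- The coefficient of `(d√𝐳)² + 𝐳 h` in `g_{(F, C)}`. -/
def coeffE (n : ℕ) (I : (ℝ → ℝ) → ℝ → ℝ) (F : ℝ → ℝ) (C : ℝ) (t : ℝ) : ℝ :=
  deriv (fun s => s * F s) t - 2 / (t ^ (n - 1) * F t ^ (n - 2)) * (I F t + C)⁻¹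

/-- The tensor `g_{(F, C)}`. -/
def metricFC (n : ℕ) (I : (ℝ → ℝ) → ℝ → ℝ) (F : ℝ → ℝ) (C : ℝ) : TensorField n := fun p =>
  coeffE n I F C (radial p) • (dSqrtRadialSq n p + radial p • hopfMetric n p)
    + (radial p * F (radial p)) • fubiniStudy n p

end Klsc

end

/-!
A `U(n)`-invariant Hermitian metric on the annulus has the form
`f(𝐳) ⟨·,·⟩ + k(𝐳) (x ⊗ x + y ⊗ y)` with `x = ⟨p, ·⟩` and `y = ⟨√-1 p, ·⟩`, because `U(n)` acts
transitively on orthonormal pairs (`eq_radialTensor_of_invariant`); here `f = F` and `f + k 𝐳 = E`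
are the coefficients across and along the complex lines through the origin. For such a metric
everything is computable in closed form.

The inverse metric, the Christoffel symbols and the Ricci tensor are combinations of `δ`, `J`, `x`
and `y` whose coefficients are functions of `𝐳`, so that the scalar curvature reduces to finitely
many contractions (`sum_sum_gammaForm`, `sum_gammaGrad`, `scalarCurvature_eq`). The Chern scalar
curvature only needs the trace of the Chern connection, which is `∂ log det g`
(`chernScalarCurvature_eq`). With the torsion coefficient `d = f' - k` one finds
`dω = 2 d x ∧ ω₀` (`dAssocForm_eq`), and `S - 2 S_C` is a nowhere zero multiple of
`2 f (n d + 𝐳 d') + (2 n - 4) 𝐳 f' d + 𝐳 d²` (`scalarCurvature_sub_chern`).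

In terms of the torsion function `u = 𝐳ⁿ fⁿ⁻² d` the Klsc condition becomes the Bernoulli equation
`2 𝐳ⁿ fⁿ⁻¹ u' = -u²` (`klsc_iff_torsion`). A solution with a zero vanishes identically
(`eq_zero_of_bernoulli`), in which case the metric is Kähler. Otherwise the equation says
`(2 / u)' = 1 / (𝐳ⁿ fⁿ⁻¹)`, that is `2 / u = ∫ d𝐳 / (𝐳ⁿ Fⁿ⁻¹) + C`. Solving for `E` gives the
formula for `g_{(F, C)}`, and `E > 0` is exactly the monotonicity required of an admissible pair
(`deriv_admissible`).
-/

open scoped ContDiff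

noncomputable section

namespace Klsc

open Matrix

/-! ### Contractions of the tensors built from `δ`, `J`, `x` and `y = J x` -/

section Contraction

variable {ι : Type*} [Fintype ι] [DecidableEq ι]

/-- `J` is an orthogonal complex structure, `y = J x` and `z = |x|²`. -/
structure IsRotatedPair (J : Matrix ι ι ℝ) (x y : ι → ℝ) (z : ℝ) : Prop where
  sq : J * J = -1
  skew : Jᵀ = -J
  map : J *ᵥ x = y
  norm_sq : x ⬝ᵥ x = z

namespace IsRotatedPair

variable {J : Matrix ι ι ℝ} {x y : ι → ℝ} {z : ℝ} (h : IsRotatedPair J x y z)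
include h

lemma apply_swap (a b : ι) : J b a = -J a b := by
  have := congrFun (congrFun h.skew a) b
  simpa using this

lemma apply_self (a : ι) : J a a = 0 := by
  have := h.apply_swap a a
  linarith

lemma mulVec_snd : J *ᵥ y = -x := by
  rw [← h.map, mulVec_mulVec, h.sq, neg_mulVec, one_mulVec]

lemma vecMul_eq (v : ι → ℝ) : v ᵥ* J = -(J *ᵥ v) := by
  rw [← mulVec_transpose, h.skew, neg_mulVec]

lemma dot_snd : x ⬝ᵥ y = 0 := by
  have h1 : x ⬝ᵥ (J *ᵥ x) = -(x ⬝ᵥ (J *ᵥ x)) := by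
    conv_lhs => rw [dotProduct_mulVec, h.vecMul_eq, neg_dotProduct, dotProduct_comm]
  rw [h.map] at h1
  linarith

lemma snd_dot : y ⬝ᵥ x = 0 := by rw [dotProduct_comm, h.dot_snd]

lemma snd_dot_snd : y ⬝ᵥ y = z := by
  conv_lhs => rw [← h.map, dotProduct_mulVec, h.vecMul_eq, h.map, h.mulVec_snd, neg_neg]
  exact h.norm_sq

lemma dot_col (v : ι → ℝ) (b : ι) : v ⬝ᵥ J.col b = -(J *ᵥ v) b :=
  congrFun (h.vecMul_eq v) b

lemma col_dot (v : ι → ℝ) (b : ι) : J.col b ⬝ᵥ v = -(J *ᵥ v) b := by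
  rw [dotProduct_comm, h.dot_col]

lemma mulVec_col (b : ι) : J *ᵥ J.col b = -Pi.single b 1 := by
  rw [← mulVec_single_one, mulVec_mulVec, h.sq, neg_mulVec, one_mulVec]

lemma trace_eq_zero : J.trace = 0 := by
  simp [trace, h.apply_self]

end IsRotatedPair

/-- The shape of the Christoffel symbols `Γ^c_{ab}` of a metric `f δ + k (x xᵀ + y yᵀ)`. -/
def gammaForm (J : Matrix ι ι ℝ) (A B K P Q R : ℝ) (x y : ι → ℝ) (c a b : ι) : ℝ :=
  A * (x a * (1 : Matrix ι ι ℝ) b c + x b * (1 : Matrix ι ι ℝ) a c)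
    + B * (x c * (1 : Matrix ι ι ℝ) a b)
    + K * (J c a * y b + J c b * y a) + P * (x a * x b * x c) + Q * (x c * y a * y b)
    + R * (y c * (x a * y b + x b * y a))

variable (J : Matrix ι ι ℝ) (A B K P Q R : ℝ) (x y : ι → ℝ) (z : ℝ)

omit [Fintype ι] in
lemma gammaForm_comm (c a b : ι) :
    gammaForm J A B K P Q R x y c a b = gammaForm J A B K P Q R x y c b a := by
  have h : (1 : Matrix ι ι ℝ) a b = (1 : Matrix ι ι ℝ) b a := by simp [one_apply, eq_comm]
  simp only [gammaForm, h]
  ring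

/-- The endomorphism `v ↦ Γ(e_b, v)`. It is a combination of `1`, `J` and rank one matrices, so
traces of products of such endomorphisms reduce to dot products. -/
def gammaMatrix (b : ι) : Matrix ι ι ℝ :=
  Matrix.of fun a e => gammaForm J A B K P Q R x y a b e

omit [Fintype ι] in
lemma gammaMatrix_eq (b : ι) : gammaMatrix J A B K P Q R x y b =
    (A * x b) • (1 : Matrix ι ι ℝ) + (K * y b) • J + A • vecMulVec (Pi.single b 1) x
      + K • vecMulVec (J.col b) y
      + vecMulVec x (B • Pi.single b 1 + (P * x b) • x + (Q * y b) • y)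
      + vecMulVec y ((R * x b) • y + (R * y b) • x) := by
  ext a e
  simp only [gammaMatrix, gammaForm, of_apply, Matrix.add_apply, Matrix.smul_apply, vecMulVec_apply,
    Pi.add_apply, Pi.smul_apply, smul_eq_mul, col_apply, Pi.single_apply, one_apply, eq_comm]
  split_ifs <;> ring

variable {J x y z} (h : IsRotatedPair J x y z)
include h

/-- The trace `Γ^a_{ab}`. -/
lemma sum_gammaForm_self (b : ι) : ∑ a, gammaForm J A B K P Q R x y a a b =
    ((Fintype.card ι + 1) * A + B + K + (P + R) * z) * x b := by
  have h1 : ∑ a, gammaForm J A B K P Q R x y a a b = (gammaMatrix J A B K P Q R x y b).trace := by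
    simp only [trace, diag_apply, gammaMatrix, of_apply]
    exact Finset.sum_congr rfl fun a _ => gammaForm_comm ..
  rw [h1, gammaMatrix_eq]
  simp only [trace_add, trace_smul, trace_one, trace_vecMulVec, h.trace_eq_zero, dotProduct_add,
    dotProduct_smul, h.norm_sq, h.dot_snd, h.snd_dot, h.snd_dot_snd, smul_eq_mul, single_dotProduct,
    dotProduct_single]
  rw [dotProduct_comm, h.dot_col, h.mulVec_snd]
  simp only [Pi.neg_apply]
  ring

/-- The contraction `x_e Γ^e_{bc}`. -/
lemma sum_mul_gammaForm (b c : ι) : ∑ e, x e * gammaForm J A B K P Q R x y e b c =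
    (B * z) * (1 : Matrix ι ι ℝ) b c + (2 * A + P * z) * (x b * x c)
      + (Q * z - 2 * K) * (y b * y c) := by
  have h0 : ∑ e, x e * gammaForm J A B K P Q R x y e b c
      = (x ᵥ* gammaMatrix J A B K P Q R x y b) c := by
    simp [vecMul, dotProduct, gammaMatrix]
  rw [h0, gammaMatrix_eq]
  simp only [vecMul_add, vecMul_smul, vecMul_one, vecMul_vecMulVec, h.vecMul_eq, h.map,
    h.norm_sq, h.dot_snd, dotProduct_single, h.dot_col, Pi.add_apply, Pi.smul_apply, Pi.neg_apply,
    smul_eq_mul, Pi.single_apply, one_apply, eq_comm]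
  split_ifs <;> ring

/-- The contraction `Γ^a_{be} Γ^e_{ac}`, computed as the trace of a product of two
`gammaMatrix`es. -/
lemma sum_sum_gammaForm (b c : ι) :
    ∑ a, ∑ e, gammaForm J A B K P Q R x y a b e * gammaForm J A B K P Q R x y e a c =
    (2 * A * B * z) * (1 : Matrix ι ι ℝ) b c
      + (Fintype.card ι * A ^ 2 + 3 * A ^ 2 + 2 * A * K + 2 * A * (B + P * z) + 2 * A * R * z
          + 2 * A * P * z + K ^ 2 + 2 * K * R * z + (B + P * z) ^ 2 + R ^ 2 * z ^ 2) * (x b * x c)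
      + (2 * K * (B + Q * z) - Fintype.card ι * K ^ 2 - 4 * A * K - 2 * K ^ 2 - 4 * K * R * z
          + 2 * A * Q * z + 2 * (B + Q * z) * R * z) * (y b * y c) := by
  have h1 : ∑ a, ∑ e, gammaForm J A B K P Q R x y a b e * gammaForm J A B K P Q R x y e a c =
      (gammaMatrix J A B K P Q R x y b * gammaMatrix J A B K P Q R x y c).trace := by
    simp only [trace, diag_apply, mul_apply, gammaMatrix, of_apply]
    exact Finset.sum_congr rfl fun a _ => Finset.sum_congr rfl fun e _ => by
      rw [gammaForm_comm J A B K P Q R x y e a c]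
  rw [h1, gammaMatrix_eq, gammaMatrix_eq]
  simp only [mul_add, add_mul, smul_mul_assoc, mul_smul_comm, one_mul, mul_one,
    vecMulVec_mul_vecMulVec, mul_vecMulVec J, vecMulVec_mul _ _ J,
    trace_add, trace_smul, trace_one, trace_vecMulVec, h.trace_eq_zero, h.sq, trace_neg,
    vecMulVec_smul, vecMulVec_add, smul_add,
    h.norm_sq, h.dot_snd,
    h.snd_dot, h.snd_dot_snd, smul_eq_mul, single_dotProduct, mulVec_single_one, h.mulVec_col,
    dotProduct_neg, neg_dotProduct, smul_neg,
    dotProduct_single, h.dot_col, h.col_dot, h.mulVec_snd, h.map, Pi.neg_apply, h.vecMul_eq,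
    mulVec_neg, Pi.single_apply, one_apply, eq_comm]
  split_ifs <;> ring

/-- The derivative in the direction `e` of `gammaForm`, whose coefficients are functions of `z` with
derivatives `A₁, …, R₁`, given that `∂_e z = 2 x_e`, `∂_e x_b = δ_be` and `∂_e y_b = J_be`. -/
def gammaGrad (J : Matrix ι ι ℝ) (A B K P Q R A₁ B₁ K₁ P₁ Q₁ R₁ : ℝ) (x y : ι → ℝ)
    (c a b e : ι) : ℝ :=
  2 * x e * gammaForm J A₁ B₁ K₁ P₁ Q₁ R₁ x y c a b
    + A * ((1 : Matrix ι ι ℝ) a e * (1 : Matrix ι ι ℝ) b c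
      + (1 : Matrix ι ι ℝ) b e * (1 : Matrix ι ι ℝ) a c)
    + B * ((1 : Matrix ι ι ℝ) c e * (1 : Matrix ι ι ℝ) a b)
    + K * (J c a * J b e + J c b * J a e)
    + P * ((1 : Matrix ι ι ℝ) a e * x b * x c + x a * (1 : Matrix ι ι ℝ) b e * x c
      + x a * x b * (1 : Matrix ι ι ℝ) c e)
    + Q * ((1 : Matrix ι ι ℝ) c e * y a * y b + x c * J a e * y b + x c * y a * J b e)
    + R * (J c e * (x a * y b + x b * y a) + y c * ((1 : Matrix ι ι ℝ) a e * y b + x a * J b e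
      + (1 : Matrix ι ι ℝ) b e * y a + x b * J a e))

/-- The divergence `∂_a Γ^a_{bc}`. -/
lemma sum_gammaGrad (A₁ B₁ K₁ P₁ Q₁ R₁ : ℝ) (b c : ι) :
    ∑ e, gammaGrad J A B K P Q R A₁ B₁ K₁ P₁ Q₁ R₁ x y e b c e =
      (2 * B₁ * z + 2 * A + Fintype.card ι * B - 2 * K) * (1 : Matrix ι ι ℝ) b c
        + (4 * A₁ + 2 * P₁ * z + (Fintype.card ι + 2) * P - 2 * R) * (x b * x c)
        + (2 * Q₁ * z - 4 * K₁ + (Fintype.card ι + 2) * Q + 2 * R) * (y b * y c) := by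
  have e1 : ∑ e, (1 : Matrix ι ι ℝ) b e * (1 : Matrix ι ι ℝ) c e = (1 : Matrix ι ι ℝ) b c := by
    simp [one_apply]
  have e2 : ∑ e, J e b * J c e = -(1 : Matrix ι ι ℝ) b c := by
    have := congrFun (congrFun h.sq c) b
    rw [mul_apply] at this
    simpa [mul_comm, one_apply, eq_comm] using this
  have e2' : ∑ e, J e c * J b e = -(1 : Matrix ι ι ℝ) b c := by
    have := congrFun (congrFun h.sq b) c
    rw [mul_apply] at this
    simpa [mul_comm, one_apply, eq_comm] using this
  have e3 (b : ι) : ∑ e, (1 : Matrix ι ι ℝ) b e * x e = x b := by simp [one_apply]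
  have e4 (b : ι) : ∑ e, (1 : Matrix ι ι ℝ) b e * y e = y b := by simp [one_apply]
  have e5 (b : ι) : ∑ e, J b e * x e = y b := congrFun h.map b
  have e6 (b : ι) : ∑ e, J b e * y e = -x b := congrFun h.mulVec_snd b
  have e7 : ∑ e, J e e = 0 := h.trace_eq_zero
  have e8 : ∑ e, (1 : Matrix ι ι ℝ) e e = Fintype.card ι := by simp
  calc ∑ e, gammaGrad J A B K P Q R A₁ B₁ K₁ P₁ Q₁ R₁ x y e b c e
    _ = ∑ e, (2 * (x e * gammaForm J A₁ B₁ K₁ P₁ Q₁ R₁ x y e b c)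
          + 2 * A * ((1 : Matrix ι ι ℝ) b e * (1 : Matrix ι ι ℝ) c e)
          + B * (1 : Matrix ι ι ℝ) b c * (1 : Matrix ι ι ℝ) e e
          + K * (J e b * J c e) + K * (J e c * J b e)
          + P * x c * ((1 : Matrix ι ι ℝ) b e * x e) + P * x b * ((1 : Matrix ι ι ℝ) c e * x e)
          + P * x b * x c * (1 : Matrix ι ι ℝ) e e
          + Q * y b * y c * (1 : Matrix ι ι ℝ) e e
          + Q * y c * (J b e * x e) + Q * y b * (J c e * x e)
          + R * (x b * y c + x c * y b) * J e e
          + R * y c * ((1 : Matrix ι ι ℝ) b e * y e) + R * y b * ((1 : Matrix ι ι ℝ) c e * y e)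
          + R * x b * (J c e * y e) + R * x c * (J b e * y e)) := by
        refine Finset.sum_congr rfl fun e _ => ?_
        rw [gammaGrad]
        ring
    _ = _ := by
        simp only [Finset.sum_add_distrib, ← Finset.mul_sum, e1, e2, e2', e3, e4, e5, e6, e7, e8,
          sum_mul_gammaForm _ _ _ _ _ _ h]
        ring

/-- Raising the index `d` of the lowered Christoffel symbols of `f δ + k (x xᵀ + y yᵀ)` with the
inverse metric `f⁻¹ δ - m (x xᵀ + y yᵀ)`. -/
lemma sum_inverse_mul_lowered {f k f₁ k₁ E m : ℝ} (hf : f ≠ 0) (hE : E ≠ 0) (hfE : E = f + k * z)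
    (hm : m = k / (f * E)) (c a b : ι) :
    (1 / 2) * ∑ d, (f⁻¹ * (1 : Matrix ι ι ℝ) c d - m * (x c * x d + y c * y d)) *
      ((2 * x a * f₁ * (1 : Matrix ι ι ℝ) b d + 2 * x a * k₁ * (x b * x d + y b * y d)
          + k * ((1 : Matrix ι ι ℝ) b a * x d + x b * (1 : Matrix ι ι ℝ) d a + J b a * y d
            + y b * J d a))
        + (2 * x b * f₁ * (1 : Matrix ι ι ℝ) a d + 2 * x b * k₁ * (x a * x d + y a * y d)
          + k * ((1 : Matrix ι ι ℝ) a b * x d + x a * (1 : Matrix ι ι ℝ) d b + J a b * y d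
            + y a * J d b))
        - (2 * x d * f₁ * (1 : Matrix ι ι ℝ) a b + 2 * x d * k₁ * (x a * x b + y a * y b)
          + k * ((1 : Matrix ι ι ℝ) a d * x b + x a * (1 : Matrix ι ι ℝ) b d + J a d * y b
            + y a * J b d))) =
    gammaForm J (f₁ / f) ((k - f₁) / E) (k / f) (k₁ / E - 2 * f₁ * m) (2 * k * m - k₁ / E)
      (k₁ / E - f₁ * m - k * m) x y c a b := by
  have one_comm (a b : ι) : (1 : Matrix ι ι ℝ) b a = (1 : Matrix ι ι ℝ) a b := by
    simp [one_apply, eq_comm]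
  -- the lowered symbols, before contraction
  have key (d : ι) : (f⁻¹ * (1 : Matrix ι ι ℝ) c d - m * (x c * x d + y c * y d)) *
      ((2 * x a * f₁ * (1 : Matrix ι ι ℝ) b d + 2 * x a * k₁ * (x b * x d + y b * y d)
          + k * ((1 : Matrix ι ι ℝ) b a * x d + x b * (1 : Matrix ι ι ℝ) d a + J b a * y d
            + y b * J d a))
        + (2 * x b * f₁ * (1 : Matrix ι ι ℝ) a d + 2 * x b * k₁ * (x a * x d + y a * y d)
          + k * ((1 : Matrix ι ι ℝ) a b * x d + x a * (1 : Matrix ι ι ℝ) d b + J a b * y d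
            + y a * J d b))
        - (2 * x d * f₁ * (1 : Matrix ι ι ℝ) a b + 2 * x d * k₁ * (x a * x b + y a * y b)
          + k * ((1 : Matrix ι ι ℝ) a d * x b + x a * (1 : Matrix ι ι ℝ) b d + J a d * y b
            + y a * J b d))) =
      2 * ((f⁻¹ * (1 : Matrix ι ι ℝ) c d - m * (x c * x d + y c * y d)) *
        (f₁ * x a * (1 : Matrix ι ι ℝ) d b + f₁ * x b * (1 : Matrix ι ι ℝ) d a
          + ((k - f₁) * (1 : Matrix ι ι ℝ) a b + k₁ * (x a * x b - y a * y b)) * x d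
          + k₁ * (x a * y b + x b * y a) * y d
          + k * y b * J d a + k * y a * J d b)) := by
    rw [h.apply_swap a b, h.apply_swap d a, h.apply_swap d b, one_comm d b, one_comm d a,
      one_comm a b]
    ring
  have dot (v : ι → ℝ) (c₁ c₂ c₃ c₄ c₅ c₆ : ℝ) :
      ∑ d, v d * (c₁ * (1 : Matrix ι ι ℝ) d b + c₂ * (1 : Matrix ι ι ℝ) d a + c₃ * x d + c₄ * y d
        + c₅ * J d a + c₆ * J d b) = c₁ * v b + c₂ * v a + c₃ * (v ⬝ᵥ x) + c₄ * (v ⬝ᵥ y)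
        - c₅ * (J *ᵥ v) a - c₆ * (J *ᵥ v) b := by
    have d1 := h.dot_col v a
    have d2 := h.dot_col v b
    simp only [dotProduct, col_apply] at d1 d2
    have e1 (b : ι) : ∑ d, v d * (1 : Matrix ι ι ℝ) d b = v b := by simp [one_apply]
    calc _ = ∑ d, (c₁ * (v d * (1 : Matrix ι ι ℝ) d b) + c₂ * (v d * (1 : Matrix ι ι ℝ) d a)
          + c₃ * (v d * x d) + c₄ * (v d * y d) + c₅ * (v d * J d a) + c₆ * (v d * J d b)) :=
        Finset.sum_congr rfl fun d _ => by ring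
      _ = _ := by
        simp only [Finset.sum_add_distrib, ← Finset.mul_sum, e1, d1, d2, dotProduct]
        ring
  have split (T : ι → ℝ) : ∑ d, (f⁻¹ * (1 : Matrix ι ι ℝ) c d - m * (x c * x d + y c * y d)) * T d
      = f⁻¹ * T c - m * (x c * ∑ d, x d * T d + y c * ∑ d, y d * T d) := by
    have e1 : ∑ d, (1 : Matrix ι ι ℝ) c d * T d = T c := by simp [one_apply]
    conv_rhs => rw [← e1]
    simp only [Finset.mul_sum, ← Finset.sum_add_distrib, ← Finset.sum_sub_distrib]
    exact Finset.sum_congr rfl fun d _ => by ring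
  simp only [key, ← Finset.mul_sum]
  rw [split]
  simp only [dot, h.norm_sq, h.dot_snd, h.snd_dot, h.snd_dot_snd, h.map, h.mulVec_snd,
    Pi.neg_apply, gammaForm]
  have hE' : f + k * z ≠ 0 := hfE ▸ hE
  rw [one_comm c b, one_comm c a, hm, hfE]
  field_simp
  ring

end Contraction

/-! ### Real coordinates and partial derivatives -/

section Coordinates

variable {n : ℕ}

lemma real_inner_eq_re (v w : Cn n) : inner ℝ v w = (inner ℂ v w : ℂ).re := by
  simp [PiLp.inner_apply]

lemma real_inner_eq_sum (v w : Cn n) :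
    inner ℝ v w = ∑ i, ((v i).re * (w i).re + (v i).im * (w i).im) := by
  simp [PiLp.inner_apply, mul_comm]

lemma radial_eq_norm_sq (p : Cn n) : radial p = ‖p‖ ^ 2 := (EuclideanSpace.norm_sq_eq p).symm

lemma radial_eq_inner (p : Cn n) : radial p = inner ℝ p p := by
  rw [radial_eq_norm_sq, real_inner_self_eq_norm_sq]

/-- The real coordinates `(x₁, …, xₙ, y₁, …, yₙ)` of `p`. -/
def reCoord (p : Cn n) (b : Fin n ⊕ Fin n) : ℝ := innerSL ℝ (realBasis n b) p

/-- The real coordinates of `√-1 p`. -/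
def rotCoord (p : Cn n) (b : Fin n ⊕ Fin n) : ℝ := innerSL ℝ (realBasis n b) (Complex.I • p)

@[simp] lemma reCoord_inl (p : Cn n) (j : Fin n) : reCoord p (Sum.inl j) = (p j).re := by
  simp [reCoord, realBasis, real_inner_eq_re, EuclideanSpace.inner_single_left]

@[simp] lemma reCoord_inr (p : Cn n) (j : Fin n) : reCoord p (Sum.inr j) = (p j).im := by
  simp [reCoord, realBasis, real_inner_eq_re, EuclideanSpace.inner_single_left]

@[simp] lemma rotCoord_inl (p : Cn n) (j : Fin n) : rotCoord p (Sum.inl j) = -(p j).im := by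
  simp [rotCoord, realBasis, real_inner_eq_re, EuclideanSpace.inner_single_left]

@[simp] lemma rotCoord_inr (p : Cn n) (j : Fin n) : rotCoord p (Sum.inr j) = (p j).re := by
  simp [rotCoord, realBasis, real_inner_eq_re, EuclideanSpace.inner_single_left]

lemma reCoord_realBasis (a b : Fin n ⊕ Fin n) :
    reCoord (realBasis n a) b = (1 : Matrix (Fin n ⊕ Fin n) (Fin n ⊕ Fin n) ℝ) b a := by
  rcases a with a | a <;> rcases b with b | b <;>
    simp [realBasis, one_apply, apply_ite Complex.re, apply_ite Complex.im]

lemma rotCoord_realBasis (a b : Fin n ⊕ Fin n) :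
    rotCoord (realBasis n a) b = Matrix.J (Fin n) ℝ b a := by
  rcases a with a | a <;> rcases b with b | b <;>
    simp [realBasis, Matrix.J, one_apply, apply_ite Complex.re,
      apply_ite Complex.im]

lemma isRotatedPair (p : Cn n) :
    IsRotatedPair (Matrix.J (Fin n) ℝ) (reCoord p) (rotCoord p) (radial p) where
  sq := J_squared _ _
  skew := J_transpose _ _
  map := by
    ext b
    rcases b with b | b <;> simp [Matrix.J, mulVec, dotProduct, one_apply]
  norm_sq := by
    simp only [dotProduct, Fintype.sum_sum_type, reCoord_inl, reCoord_inr, radial_eq_inner,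
      real_inner_eq_sum, Finset.sum_add_distrib]

/-- `f` is differentiable at `p` with real partial derivatives `d`. -/
structure HasPartials (f : Cn n → ℝ) (d : Fin n ⊕ Fin n → ℝ) (p : Cn n) : Prop where
  differentiableAt : DifferentiableAt ℝ f p
  realPartial_eq : ∀ a, realPartial a f p = d a

namespace HasPartials

variable {f g : Cn n → ℝ} {d e : Fin n ⊕ Fin n → ℝ} {p : Cn n}

lemma of_eq (hf : HasPartials f d p) (h : ∀ a, d a = e a) : HasPartials f e p :=
  ⟨hf.1, fun a => (hf.2 a).trans (h a)⟩

lemma congr (hf : HasPartials f d p) (h : g =ᶠ[nhds p] f) : HasPartials g d p :=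
  ⟨hf.1.congr_of_eventuallyEq h, fun a => by rw [realPartial, h.fderiv_eq]; exact hf.2 a⟩

lemma const (c : ℝ) (p : Cn n) : HasPartials (fun _ => c) 0 p :=
  ⟨differentiableAt_const c, fun a => by simp [realPartial]⟩

lemma add (hf : HasPartials f d p) (hg : HasPartials g e p) :
    HasPartials (fun q => f q + g q) (fun a => d a + e a) p :=
  ⟨hf.1.add hg.1, fun a => by
    rw [realPartial, fderiv_fun_add hf.1 hg.1, ← hf.2, ← hg.2]; rfl⟩

lemma mul (hf : HasPartials f d p) (hg : HasPartials g e p) :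
    HasPartials (fun q => f q * g q) (fun a => d a * g p + f p * e a) p :=
  ⟨hf.1.mul hg.1, fun a => by
    rw [realPartial, fderiv_fun_mul hf.1 hg.1, ← hf.2, ← hg.2]
    simp [realPartial]; ring⟩

lemma mul_const (hf : HasPartials f d p) (c : ℝ) :
    HasPartials (fun q => f q * c) (fun a => d a * c) p :=
  (hf.mul (const c p)).of_eq fun a => by simp

lemma const_mul (hf : HasPartials f d p) (c : ℝ) :
    HasPartials (fun q => c * f q) (fun a => c * d a) p :=
  ((const c p).mul hf).of_eq fun a => by simp

lemma sum {ι : Type*} [Fintype ι] {f : ι → Cn n → ℝ} {d : ι → Fin n ⊕ Fin n → ℝ}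
    (h : ∀ i, HasPartials (f i) (d i) p) :
    HasPartials (fun q => ∑ i, f i q) (fun a => ∑ i, d i a) p :=
  ⟨DifferentiableAt.fun_sum fun i _ => (h i).1, fun a => by
    rw [realPartial, fderiv_fun_sum fun i _ => (h i).1, _root_.sum_apply]
    exact Finset.sum_congr rfl fun i _ => (h i).2 a⟩

lemma reCoord (b : Fin n ⊕ Fin n) (p : Cn n) : HasPartials (fun q => reCoord q b)
    (fun a => (1 : Matrix (Fin n ⊕ Fin n) (Fin n ⊕ Fin n) ℝ) b a) p :=
  ⟨(innerSL ℝ (realBasis n b)).differentiableAt, fun a => by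
    rw [← reCoord_realBasis]
    exact congrArg (fun L => L (realBasis n a)) (innerSL ℝ (realBasis n b)).fderiv⟩

lemma rotCoord (b : Fin n ⊕ Fin n) (p : Cn n) : HasPartials (fun q => rotCoord q b)
    (fun a => Matrix.J (Fin n) ℝ b a) p := by
  have h : HasFDerivAt (fun q : Cn n => Klsc.rotCoord q b)
      ((innerSL ℝ (realBasis n b)).comp
        ((Complex.I • ContinuousLinearMap.id ℝ (Cn n) : Cn n →L[ℝ] Cn n))) p :=
    ((innerSL ℝ (realBasis n b)).comp
      (Complex.I • ContinuousLinearMap.id ℝ (Cn n) : Cn n →L[ℝ] Cn n)).hasFDerivAt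
  refine ⟨h.differentiableAt, fun a => ?_⟩
  rw [← rotCoord_realBasis, realPartial, h.fderiv]
  rfl

end HasPartials

lemma hasFDerivAt_radial (p : Cn n) : HasFDerivAt (radial (n := n)) (2 • innerSL ℝ p) p := by
  have h := (hasStrictFDerivAt_norm_sq p).hasFDerivAt
  exact h.congr_of_eventuallyEq (Filter.Eventually.of_forall radial_eq_norm_sq)

lemma inner_realBasis (p : Cn n) (a : Fin n ⊕ Fin n) :
    inner ℝ p (realBasis n a) = reCoord p a := by
  rw [reCoord, innerSL_apply_apply, real_inner_comm]

lemma inner_I_smul_realBasis (p : Cn n) (a : Fin n ⊕ Fin n) :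
    inner ℝ (Complex.I • p) (realBasis n a) = rotCoord p a := by
  rw [rotCoord, innerSL_apply_apply, real_inner_comm]

lemma HasPartials.comp_radial {φ : ℝ → ℝ} {φ' : ℝ} {p : Cn n} (h : HasDerivAt φ φ' (radial p)) :
    HasPartials (fun q => φ (radial q)) (fun a => φ' * (2 * Klsc.reCoord p a)) p := by
  have h' := h.comp_hasFDerivAt p (hasFDerivAt_radial p)
  refine ⟨h'.differentiableAt, fun a => ?_⟩
  rw [← inner_realBasis]
  refine (congrArg (fun L => L (realBasis n a)) h'.fderiv).trans ?_
  simp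

end Coordinates

/-! ### Levi-Civita connection and scalar curvature of a radial metric -/

section LeviCivita

variable {n : ℕ}

/-- The tensor `f(𝐳) ⟨·,·⟩ + k(𝐳) (x ⊗ x + y ⊗ y)`, where `x = ⟨p, ·⟩` and `y = ⟨√-1 p, ·⟩`. -/
def radialTensor (n : ℕ) (f k : ℝ → ℝ) : TensorField n := fun p =>
  f (radial p) • euclideanMetric n + k (radial p) • ((innerSL ℝ p).smulRight (innerSL ℝ p)
    + (innerSL ℝ (Complex.I • p)).smulRight (innerSL ℝ (Complex.I • p)))

lemma radialTensor_apply (f k : ℝ → ℝ) (p v w : Cn n) : radialTensor n f k p v w =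
    f (radial p) * inner ℝ v w + k (radial p) * (inner ℝ p v * inner ℝ p w
      + inner ℝ (Complex.I • p) v * inner ℝ (Complex.I • p) w) := by
  rfl

lemma gram_radialTensor {g : TensorField n} {f k : ℝ → ℝ} {p : Cn n}
    (hg : g p = radialTensor n f k p) (a b : Fin n ⊕ Fin n) : gram g p a b =
      f (radial p) * (1 : Matrix (Fin n ⊕ Fin n) (Fin n ⊕ Fin n) ℝ) a b
        + k (radial p) * (reCoord p a * reCoord p b + rotCoord p a * rotCoord p b) := by
  rw [gram, of_apply, hg, radialTensor_apply]
  simp only [inner_I_smul_realBasis p]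
  simp only [inner_realBasis, reCoord_realBasis]
  simp only [one_apply, eq_comm]

lemma gram_inv_radialTensor {g : TensorField n} {f k : ℝ → ℝ} {p : Cn n}
    (hg : g p = radialTensor n f k p) (hf : f (radial p) ≠ 0)
    (hE : f (radial p) + k (radial p) * radial p ≠ 0) (a b : Fin n ⊕ Fin n) : (gram g p)⁻¹ a b =
      (f (radial p))⁻¹ * (1 : Matrix (Fin n ⊕ Fin n) (Fin n ⊕ Fin n) ℝ) a b
        - k (radial p) / (f (radial p) * (f (radial p) + k (radial p) * radial p))
          * (reCoord p a * reCoord p b + rotCoord p a * rotCoord p b) := by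
  have h := isRotatedPair p
  set x := reCoord p
  set y := rotCoord p
  set z := radial p
  set m := k z / (f z * (f z + k z * z)) with hm
  have hgram : gram g p = f z • (1 : Matrix (Fin n ⊕ Fin n) (Fin n ⊕ Fin n) ℝ)
      + k z • (vecMulVec x x + vecMulVec y y) := by
    ext a b
    rw [gram_radialTensor hg]
    simp [vecMulVec_apply, mul_add, x, y, z]
  have hinv : gram g p * ((f z)⁻¹ • (1 : Matrix (Fin n ⊕ Fin n) (Fin n ⊕ Fin n) ℝ)
      - m • (vecMulVec x x + vecMulVec y y)) = 1 := by
    rw [hgram]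
    simp only [mul_sub, add_mul, mul_add, smul_mul_assoc, mul_smul_comm, one_mul, mul_one,
      vecMulVec_mul_vecMulVec, h.norm_sq, h.dot_snd, h.snd_dot, h.snd_dot_snd, zero_smul,
      vecMulVec_smul, vecMulVec_zero]
    ext a b
    simp only [Matrix.add_apply, Matrix.sub_apply, Matrix.smul_apply, smul_eq_mul,
      Matrix.zero_apply, hm]
    field_simp
    ring
  rw [inv_eq_right_inv hinv]
  simp [vecMulVec_apply, mul_add]

/-- Coefficient functions of a radial metric on the set of points whose radial variable lies in
`S`, together with their first two derivatives. -/
structure IsRadialData (S : Set ℝ) (f k f₁ k₁ f₂ k₂ : ℝ → ℝ) : Prop where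
  isOpen : IsOpen S
  ne_zero : ∀ t ∈ S, f t ≠ 0
  ne_zero' : ∀ t ∈ S, f t + k t * t ≠ 0
  deriv_f : ∀ t ∈ S, HasDerivAt f (f₁ t) t
  deriv_k : ∀ t ∈ S, HasDerivAt k (k₁ t) t
  deriv_f₁ : ∀ t ∈ S, HasDerivAt f₁ (f₂ t) t
  deriv_k₁ : ∀ t ∈ S, HasDerivAt k₁ (k₂ t) t

lemma continuous_radial : Continuous (radial (n := n)) := by
  unfold radial
  fun_prop

lemma eventually_radial_mem {S : Set ℝ} (hS : IsOpen S) {p : Cn n} (hp : radial p ∈ S) :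
    ∀ᶠ q in nhds p, radial q ∈ S :=
  continuous_radial.continuousAt.eventually (hS.mem_nhds hp)

variable {S : Set ℝ} {f k f₁ k₁ f₂ k₂ : ℝ → ℝ} {g : TensorField n}

lemma hasPartials_gram (hD : IsRadialData S f k f₁ k₁ f₂ k₂)
    (hg : ∀ p, radial p ∈ S → g p = radialTensor n f k p) {p : Cn n} (hp : radial p ∈ S)
    (a b : Fin n ⊕ Fin n) : HasPartials (fun q => gram g q a b) (fun e =>
      2 * reCoord p e * f₁ (radial p) * (1 : Matrix (Fin n ⊕ Fin n) (Fin n ⊕ Fin n) ℝ) a b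
        + 2 * reCoord p e * k₁ (radial p)
          * (reCoord p a * reCoord p b + rotCoord p a * rotCoord p b)
        + k (radial p) * ((1 : Matrix (Fin n ⊕ Fin n) (Fin n ⊕ Fin n) ℝ) a e * reCoord p b
          + reCoord p a * (1 : Matrix (Fin n ⊕ Fin n) (Fin n ⊕ Fin n) ℝ) b e
          + Matrix.J (Fin n) ℝ a e * rotCoord p b + rotCoord p a * Matrix.J (Fin n) ℝ b e)) p := by
  have h1 := (HasPartials.comp_radial (hD.deriv_f _ hp)).mul_const
    ((1 : Matrix (Fin n ⊕ Fin n) (Fin n ⊕ Fin n) ℝ) a b)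
  have h2 := (HasPartials.comp_radial (hD.deriv_k _ hp)).mul
    (((HasPartials.reCoord a p).mul (HasPartials.reCoord b p)).add
      ((HasPartials.rotCoord a p).mul (HasPartials.rotCoord b p)))
  refine ((h1.add h2).congr ?_).of_eq fun e => by ring
  filter_upwards [eventually_radial_mem hD.isOpen hp] with q hq
  exact gram_radialTensor (hg q hq) a b

lemma christoffel_eq (hD : IsRadialData S f k f₁ k₁ f₂ k₂)
    (hg : ∀ p, radial p ∈ S → g p = radialTensor n f k p) {p : Cn n} (hp : radial p ∈ S)
    (c a b : Fin n ⊕ Fin n) :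
    christoffel g c a b p = gammaForm (Matrix.J (Fin n) ℝ) (f₁ (radial p) / f (radial p))
      ((k (radial p) - f₁ (radial p)) / (f (radial p) + k (radial p) * radial p))
      (k (radial p) / f (radial p))
      (k₁ (radial p) / (f (radial p) + k (radial p) * radial p) - 2 * f₁ (radial p) *
        (k (radial p) / (f (radial p) * (f (radial p) + k (radial p) * radial p))))
      (2 * k (radial p) * (k (radial p) / (f (radial p) * (f (radial p) + k (radial p) * radial p)))
        - k₁ (radial p) / (f (radial p) + k (radial p) * radial p))
      (k₁ (radial p) / (f (radial p) + k (radial p) * radial p) - f₁ (radial p) *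
        (k (radial p) / (f (radial p) * (f (radial p) + k (radial p) * radial p)))
        - k (radial p) *
          (k (radial p) / (f (radial p) * (f (radial p) + k (radial p) * radial p))))
      (reCoord p) (rotCoord p) c a b := by
  rw [← sum_inverse_mul_lowered (isRotatedPair p) (hD.ne_zero _ hp) (hD.ne_zero' _ hp) rfl rfl]
  simp only [christoffel, gram_inv_radialTensor (hg p hp) (hD.ne_zero _ hp) (hD.ne_zero' _ hp),
    (hasPartials_gram hD hg hp _ _).realPartial_eq]

lemma hasPartials_gammaForm {A B K P Q R : ℝ → ℝ} {A₁ B₁ K₁ P₁ Q₁ R₁ : ℝ} {p : Cn n}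
    (hA : HasDerivAt A A₁ (radial p)) (hB : HasDerivAt B B₁ (radial p))
    (hK : HasDerivAt K K₁ (radial p)) (hP : HasDerivAt P P₁ (radial p))
    (hQ : HasDerivAt Q Q₁ (radial p)) (hR : HasDerivAt R R₁ (radial p)) (c a b : Fin n ⊕ Fin n) :
    HasPartials (fun q => gammaForm (Matrix.J (Fin n) ℝ) (A (radial q)) (B (radial q))
        (K (radial q)) (P (radial q)) (Q (radial q)) (R (radial q)) (reCoord q) (rotCoord q) c a b)
      (gammaGrad (Matrix.J (Fin n) ℝ) (A (radial p)) (B (radial p))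
        (K (radial p)) (P (radial p)) (Q (radial p)) (R (radial p)) A₁ B₁ K₁ P₁ Q₁ R₁
        (reCoord p) (rotCoord p) c a b) p := by
  have x := fun b => HasPartials.reCoord b p
  have y := fun b => HasPartials.rotCoord b p
  refine ((((((HasPartials.comp_radial hA).mul (((x a).mul_const _).add ((x b).mul_const _))).add
    ((HasPartials.comp_radial hB).mul ((x c).mul_const _))).add
    ((HasPartials.comp_radial hK).mul (((y b).const_mul _).add ((y a).const_mul _)))).add
    ((HasPartials.comp_radial hP).mul (((x a).mul (x b)).mul (x c)))).add
    ((HasPartials.comp_radial hQ).mul (((x c).mul (y a)).mul (y b)))).add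
    ((HasPartials.comp_radial hR).mul ((y c).mul (((x a).mul (y b)).add ((x b).mul (y a)))))
    |>.of_eq fun e => ?_
  simp only [gammaGrad, gammaForm]
  ring

/-- Ricci curvature of a metric whose Christoffel symbols have the shape `gammaForm`, as a
combination of `δ_{bc}`, `x_b x_c` and `y_b y_c`. Here `ψ` is the function with `Γ^a_{ab} = ψ x_b`
and `ψ₁` is its derivative with respect to `𝐳`. -/
lemma ricci_eq {A B K P Q R : ℝ → ℝ} {A₁ B₁ K₁ P₁ Q₁ R₁ : ℝ} {p : Cn n}
    (hΓ : ∀ᶠ q in nhds p, ∀ c a b, christoffel g c a b q =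
      gammaForm (Matrix.J (Fin n) ℝ) (A (radial q)) (B (radial q))
        (K (radial q)) (P (radial q)) (Q (radial q)) (R (radial q)) (reCoord q) (rotCoord q) c a b)
    (hA : HasDerivAt A A₁ (radial p)) (hB : HasDerivAt B B₁ (radial p))
    (hK : HasDerivAt K K₁ (radial p)) (hP : HasDerivAt P P₁ (radial p))
    (hQ : HasDerivAt Q Q₁ (radial p)) (hR : HasDerivAt R R₁ (radial p))
    {z a₀ b₀ k₀ p₀ q₀ r₀ ψ ψ₁ : ℝ} (hz : radial p = z) (ha₀ : A z = a₀) (hb₀ : B z = b₀)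
    (hk₀ : K z = k₀) (hp₀ : P z = p₀) (hq₀ : Q z = q₀) (hr₀ : R z = r₀)
    (hψ : ψ = (2 * n + 1) * a₀ + b₀ + k₀ + (p₀ + r₀) * z)
    (hψ₁ : ψ₁ = (2 * n + 1) * A₁ + B₁ + K₁ + (P₁ + R₁) * z + (p₀ + r₀)) (b c : Fin n ⊕ Fin n) :
    ricci g b c p =
      ((2 * B₁ * z + 2 * a₀ + 2 * n * b₀ - 2 * k₀) - ψ + ψ * (b₀ * z) - 2 * a₀ * b₀ * z)
          * (1 : Matrix (Fin n ⊕ Fin n) (Fin n ⊕ Fin n) ℝ) b c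
        + ((4 * A₁ + 2 * P₁ * z + (2 * n + 2) * p₀ - 2 * r₀) - 2 * ψ₁ + ψ * (2 * a₀ + p₀ * z)
          - (2 * n * a₀ ^ 2 + 3 * a₀ ^ 2 + 2 * a₀ * k₀ + 2 * a₀ * (b₀ + p₀ * z) + 2 * a₀ * r₀ * z
          + 2 * a₀ * p₀ * z + k₀ ^ 2 + 2 * k₀ * r₀ * z + (b₀ + p₀ * z) ^ 2 + r₀ ^ 2 * z ^ 2))
          * (reCoord p b * reCoord p c)
        + ((2 * Q₁ * z - 4 * K₁ + (2 * n + 2) * q₀ + 2 * r₀) + ψ * (q₀ * z - 2 * k₀)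
          - (2 * k₀ * (b₀ + q₀ * z) - 2 * n * k₀ ^ 2 - 4 * a₀ * k₀ - 2 * k₀ ^ 2 - 4 * k₀ * r₀ * z
          + 2 * a₀ * q₀ * z + 2 * (b₀ + q₀ * z) * r₀ * z))
          * (rotCoord p b * rotCoord p c) := by
  have h := isRotatedPair p
  have hcard : (Fintype.card (Fin n ⊕ Fin n) : ℝ) = 2 * n := by simp; ring
  have hpart (c a b : Fin n ⊕ Fin n) :=
    (hasPartials_gammaForm hA hB hK hP hQ hR c a b).congr
      (g := christoffel g c a b) (hΓ.mono fun q hq => hq c a b)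
  have hΓp := hΓ.self_of_nhds
  subst ha₀ hb₀ hk₀ hp₀ hq₀ hr₀
  -- the derivative of the trace `Γ^a_{ac} = ψ(𝐳) x_c`
  have htrace : ∑ a, realPartial b (christoffel g a a c) p =
      2 * ψ₁ * (reCoord p b * reCoord p c)
        + ψ * (1 : Matrix (Fin n ⊕ Fin n) (Fin n ⊕ Fin n) ℝ) b c := by
    have hsum := HasPartials.sum fun a => hpart a a c
    have hid : HasDerivAt (fun t : ℝ => t) 1 (radial p) := hasDerivAt_id _
    have hψ' := ((((hA.const_mul (2 * n + 1 : ℝ)).add hB).add hK).add ((hP.add hR).mul hid))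
    have hprod := ((HasPartials.comp_radial hψ').mul (HasPartials.reCoord c p)).congr
      (g := fun q => ∑ a, christoffel g a a c q) (by
        filter_upwards [hΓ] with q hq
        simp only [hq]
        rw [sum_gammaForm_self _ _ _ _ _ _ (isRotatedPair q), hcard]
        rfl)
    have e1 := hsum.realPartial_eq b
    rw [hprod.realPartial_eq b] at e1
    have hδ : (1 : Matrix (Fin n ⊕ Fin n) (Fin n ⊕ Fin n) ℝ) c b
        = (1 : Matrix (Fin n ⊕ Fin n) (Fin n ⊕ Fin n) ℝ) b c := by
      simp [one_apply, eq_comm]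
    rw [Finset.sum_congr rfl fun a _ => (hpart a a c).realPartial_eq b, ← e1, hδ]
    simp only [Pi.add_apply, Pi.mul_apply, hz, hψ, hψ₁]
    ring
  have hdiv : ∑ a, realPartial a (christoffel g a b c) p = _ :=
    (Finset.sum_congr rfl fun a _ => (hpart a b c).realPartial_eq a).trans
      (sum_gammaGrad _ _ _ _ _ _ h _ _ _ _ _ _ b c)
  have hquad1 : ∑ a, ∑ e, christoffel g a a e p * christoffel g e b c p =
      ψ * (B z * z * (1 : Matrix (Fin n ⊕ Fin n) (Fin n ⊕ Fin n) ℝ) b c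
        + (2 * A z + P z * z) * (reCoord p b * reCoord p c)
        + (Q z * z - 2 * K z) * (rotCoord p b * rotCoord p c)) := by
    rw [Finset.sum_comm]
    simp only [← Finset.sum_mul, hΓp, sum_gammaForm_self _ _ _ _ _ _ h, hcard, hz, ← hψ, mul_assoc,
      ← Finset.mul_sum]
    rw [sum_mul_gammaForm _ _ _ _ _ _ (hz ▸ h)]
    ring
  have hquad2 : ∑ a, ∑ e, christoffel g a b e p * christoffel g e a c p = _ :=
    (Finset.sum_congr rfl fun a _ => Finset.sum_congr rfl fun e _ => by rw [hΓp, hΓp]).trans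
      (sum_sum_gammaForm _ _ _ _ _ _ h b c)
  simp only [ricci, riemann, Finset.sum_add_distrib, Finset.sum_sub_distrib]
  rw [htrace, hdiv, hquad1, hquad2, hcard, hz]
  ring

end LeviCivita

section ScalarCurvature

variable {n : ℕ} {S : Set ℝ} {f k f₁ k₁ f₂ k₂ : ℝ → ℝ} {g : TensorField n}

/-- The full contraction of the inverse metric `u δ - m (x xᵀ + y yᵀ)` with a tensor of the shape
of the Ricci tensor. -/
lemma IsRotatedPair.sum_sum_mul {ι : Type*} [Fintype ι] [DecidableEq ι] {J : Matrix ι ι ℝ}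
    {x y : ι → ℝ} {z : ℝ} (h : IsRotatedPair J x y z) (u m c₁ c₂ c₃ : ℝ) :
    ∑ b, ∑ c, (u * (1 : Matrix ι ι ℝ) b c - m * (x b * x c + y b * y c)) *
      (c₁ * (1 : Matrix ι ι ℝ) b c + c₂ * (x b * x c) + c₃ * (y b * y c)) =
      c₁ * (Fintype.card ι * u - 2 * m * z) + (c₂ + c₃) * (z * u - m * z ^ 2) := by
  have hm : ∀ (M M' : Matrix ι ι ℝ), ∑ b, ∑ c, M b c * M' b c = (M * M'ᵀ).trace := fun M M' => by
    simp [trace, mul_apply]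
  have e1 : ∀ b c, u * (1 : Matrix ι ι ℝ) b c - m * (x b * x c + y b * y c) =
      (u • (1 : Matrix ι ι ℝ) - m • (vecMulVec x x + vecMulVec y y)) b c := fun b c => by
    simp [vecMulVec_apply, mul_add]
  have e2 : ∀ b c, c₁ * (1 : Matrix ι ι ℝ) b c + c₂ * (x b * x c) + c₃ * (y b * y c) =
      (c₁ • (1 : Matrix ι ι ℝ) + c₂ • vecMulVec x x + c₃ • vecMulVec y y) b c := fun b c => by
    simp [vecMulVec_apply]
  simp only [e1, e2, hm]
  simp only [transpose_add, transpose_smul, transpose_one, transpose_vecMulVec, mul_add, sub_mul,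
    add_mul, smul_mul_assoc, mul_smul_comm, one_mul, mul_one, vecMulVec_mul_vecMulVec, h.norm_sq,
    h.dot_snd, h.snd_dot, h.snd_dot_snd, trace_add, trace_sub, trace_smul, trace_one,
    trace_vecMulVec, dotProduct_smul, smul_eq_mul]
  ring

/-- The scalar curvature of a radial metric; `E = f + k 𝐳` is the coefficient along the complex
lines through the origin. -/
lemma scalarCurvature_eq (hD : IsRadialData S f k f₁ k₁ f₂ k₂)
    (hg : ∀ p, radial p ∈ S → g p = radialTensor n f k p) {p : Cn n} {z E E₁ E₂ : ℝ} (hz : z ∈ S)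
    (hpz : radial p = z) (hE : E = f z + k z * z) (hE₁ : E₁ = f₁ z + k₁ z * z + k z)
    (hE₂ : E₂ = f₂ z + k₂ z * z + 2 * k₁ z) :
    scalarCurvature g p = E⁻¹ *
      (-4 * (z * ((E₂ * E - E₁ ^ 2) / E ^ 2) + E₁ / E)
        - (n - 1) * (8 * z * ((f₂ z * f z - f₁ z ^ 2) / f z ^ 2) + (8 * n + 4) * (f₁ z / f z)
          + (4 * n - 2) * z * (f₁ z / f z) ^ 2)
        + (n - 1) * (4 * (n - 1) * (k z / f z) - 2 * z * (k z / f z) ^ 2)) := by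
  have hp : radial p ∈ S := hpz ▸ hz
  have hf0 := hD.ne_zero z hz
  have hE0 := hD.ne_zero' z hz
  have hf := hD.deriv_f z hz
  have hk := hD.deriv_k z hz
  have hf1 := hD.deriv_f₁ z hz
  have hk1 := hD.deriv_k₁ z hz
  have hid : HasDerivAt (fun t : ℝ => t) 1 z := hasDerivAt_id _
  have hE' : HasDerivAt (fun t => f t + k t * t) E₁ z :=
    (hf.fun_add (hk.fun_mul hid)).congr_deriv (by rw [hE₁]; ring)
  have hm := hk.fun_div (hf.fun_mul hE') (mul_ne_zero hf0 hE0)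
  have hA := hf1.fun_div hf hf0
  have hB := (hk.fun_sub hf1).fun_div hE' hE0
  have hK := hk.fun_div hf hf0
  have hKE := hk1.fun_div hE' hE0
  have hP := hKE.fun_sub ((hf1.const_mul 2).fun_mul hm)
  have hQ := ((hk.const_mul 2).fun_mul hm).fun_sub hKE
  have hR := (hKE.fun_sub (hf1.fun_mul hm)).fun_sub (hk.fun_mul hm)
  subst hpz
  have hric := ricci_eq (A := fun t => f₁ t / f t) (B := fun t => (k t - f₁ t) / (f t + k t * t))
    (K := fun t => k t / f t)
    (P := fun t => k₁ t / (f t + k t * t) - 2 * f₁ t * (k t / (f t * (f t + k t * t))))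
    (Q := fun t => 2 * k t * (k t / (f t * (f t + k t * t))) - k₁ t / (f t + k t * t))
    (R := fun t => k₁ t / (f t + k t * t) - f₁ t * (k t / (f t * (f t + k t * t)))
      - k t * (k t / (f t * (f t + k t * t)))) (g := g)
    (by
      filter_upwards [eventually_radial_mem hD.isOpen hp] with q hq c a b
      exact christoffel_eq hD hg hq c a b)
    hA hB hK hP hQ hR rfl rfl rfl rfl rfl rfl rfl rfl rfl
  simp only [scalarCurvature, hric, gram_inv_radialTensor (hg p hp) hf0 hE0,
    (isRotatedPair p).sum_sum_mul]
  have hcard : (Fintype.card (Fin n ⊕ Fin n) : ℝ) = 2 * n := by simp; ring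
  rw [hcard]
  clear hric hR hQ hP hKE hK hB hA hm hE' hid hk1 hf1 hk hf
  clear hD hg hz hp
  generalize radial p = z at *
  generalize f z = f at *
  generalize k z = k at *
  generalize f₁ z = f₁ at *
  generalize k₁ z = k₁ at *
  generalize f₂ z = f₂ at *
  generalize k₂ z = k₂ at *
  subst hE hE₁ hE₂
  field_simp
  ring

end ScalarCurvature

/-! ### Chern connection and Chern scalar curvature of a radial metric -/

section Chern

variable {n : ℕ}

/-- `f` is differentiable at `p` with Wirtinger derivatives `∂_i f = d i` and `∂_ī f = d' i`. -/
structure HasWirtinger (f : Cn n → ℂ) (d d' : Fin n → ℂ) (p : Cn n) : Prop where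
  differentiableAt : DifferentiableAt ℝ f p
  dz_eq : ∀ i, dz i f p = d i
  dzbar_eq : ∀ i, dzbar i f p = d' i

namespace HasWirtinger

variable {f g : Cn n → ℂ} {d d' e e' : Fin n → ℂ} {p : Cn n}

lemma of_eq (hf : HasWirtinger f d d' p) (h : ∀ i, d i = e i) (h' : ∀ i, d' i = e' i) :
    HasWirtinger f e e' p :=
  ⟨hf.1, fun a => (hf.2 a).trans (h a), fun a => (hf.3 a).trans (h' a)⟩

lemma congr (hf : HasWirtinger f d d' p) (h : g =ᶠ[nhds p] f) : HasWirtinger g d d' p :=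
  ⟨hf.1.congr_of_eventuallyEq h, fun a => by rw [dz, h.fderiv_eq]; exact hf.2 a,
    fun a => by rw [dzbar, h.fderiv_eq]; exact hf.3 a⟩

lemma const (c : ℂ) (p : Cn n) : HasWirtinger (fun _ => c) 0 0 p :=
  ⟨differentiableAt_const c, fun a => by simp [dz], fun a => by simp [dzbar]⟩

lemma add (hf : HasWirtinger f d d' p) (hg : HasWirtinger g e e' p) :
    HasWirtinger (fun q => f q + g q) (fun a => d a + e a) (fun a => d' a + e' a) p :=
  ⟨hf.1.add hg.1,
    fun a => by
      rw [dz, fderiv_fun_add hf.1 hg.1, ← hf.2, ← hg.2]; simp only [dz, _root_.add_apply]; ring,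
    fun a => by
      rw [dzbar, fderiv_fun_add hf.1 hg.1, ← hf.3, ← hg.3]
      simp only [dzbar, _root_.add_apply]; ring⟩

lemma mul (hf : HasWirtinger f d d' p) (hg : HasWirtinger g e e' p) :
    HasWirtinger (fun q => f q * g q) (fun a => d a * g p + f p * e a)
      (fun a => d' a * g p + f p * e' a) p :=
  ⟨hf.1.mul hg.1,
    fun a => by
      rw [dz, fderiv_fun_mul hf.1 hg.1, ← hf.2, ← hg.2]
      simp only [dz, _root_.add_apply, _root_.smul_apply, smul_eq_mul]; ring,
    fun a => by
      rw [dzbar, fderiv_fun_mul hf.1 hg.1, ← hf.3, ← hg.3]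
      simp only [dzbar, _root_.add_apply, _root_.smul_apply, smul_eq_mul]; ring⟩

lemma mul_const (hf : HasWirtinger f d d' p) (c : ℂ) :
    HasWirtinger (fun q => f q * c) (fun a => d a * c) (fun a => d' a * c) p :=
  (hf.mul (const c p)).of_eq (fun a => by simp) fun a => by simp

lemma sum {ι : Type*} [Fintype ι] {f : ι → Cn n → ℂ} {d d' : ι → Fin n → ℂ}
    (h : ∀ i, HasWirtinger (f i) (d i) (d' i) p) :
    HasWirtinger (fun q => ∑ i, f i q) (fun a => ∑ i, d i a) (fun a => ∑ i, d' i a) p :=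
  ⟨DifferentiableAt.fun_sum fun i _ => (h i).1,
    fun a => by
      rw [dz, fderiv_fun_sum fun i _ => (h i).1, _root_.sum_apply, _root_.sum_apply,
        Finset.mul_sum, ← Finset.sum_sub_distrib, Finset.mul_sum]
      exact Finset.sum_congr rfl fun i _ => (h i).2 a,
    fun a => by
      rw [dzbar, fderiv_fun_sum fun i _ => (h i).1, _root_.sum_apply, _root_.sum_apply,
        Finset.mul_sum, ← Finset.sum_add_distrib, Finset.mul_sum]
      exact Finset.sum_congr rfl fun i _ => (h i).3 a⟩

lemma of_hasFDerivAt {L : Cn n →L[ℝ] ℂ} (hf : HasFDerivAt f L p)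
    (h : ∀ i, (1 / 2) * (L (EuclideanSpace.single i 1)
      - Complex.I * L (EuclideanSpace.single i Complex.I)) = d i)
    (h' : ∀ i, (1 / 2) * (L (EuclideanSpace.single i 1)
      + Complex.I * L (EuclideanSpace.single i Complex.I)) = d' i) : HasWirtinger f d d' p :=
  ⟨hf.differentiableAt, fun i => by rw [dz, hf.fderiv]; exact h i,
    fun i => by rw [dzbar, hf.fderiv]; exact h' i⟩

lemma coord (k : Fin n) (p : Cn n) : HasWirtinger (fun q => q k)
    (fun i => (1 : Matrix (Fin n) (Fin n) ℂ) k i) 0 p := by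
  have h : HasFDerivAt (fun q : Cn n => q k)
      ((EuclideanSpace.proj k : Cn n →L[ℂ] ℂ).restrictScalars ℝ) p :=
    ((EuclideanSpace.proj k : Cn n →L[ℂ] ℂ).restrictScalars ℝ).hasFDerivAt
  refine of_hasFDerivAt h (fun i => ?_) fun i => ?_ <;>
  · by_cases hik : k = i <;> simp [one_apply, hik] <;> norm_num

lemma conj_coord (k : Fin n) (p : Cn n) : HasWirtinger (fun q => star (q k)) 0
    (fun i => (1 : Matrix (Fin n) (Fin n) ℂ) k i) p := by
  have h : HasFDerivAt (fun q : Cn n => star (q k))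
      ((Complex.conjCLE : ℂ →L[ℝ] ℂ).comp
        ((EuclideanSpace.proj k : Cn n →L[ℂ] ℂ).restrictScalars ℝ)) p :=
    ((Complex.conjCLE : ℂ →L[ℝ] ℂ).comp
        ((EuclideanSpace.proj k : Cn n →L[ℂ] ℂ).restrictScalars ℝ)).hasFDerivAt
  refine of_hasFDerivAt h (fun i => ?_) fun i => ?_ <;>
  · by_cases hik : k = i <;> simp [one_apply, hik] <;> norm_num

lemma comp_radial {φ : ℝ → ℝ} {φ' : ℝ} {p : Cn n} (h : HasDerivAt φ φ' (radial p)) :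
    HasWirtinger (fun q => (φ (radial q) : ℂ)) (fun i => φ' * star (p i)) (fun i => φ' * p i) p := by
  have h' := Complex.ofRealCLM.hasFDerivAt.comp p (h.comp_hasFDerivAt p (hasFDerivAt_radial p))
  have e1 (i : Fin n) : inner ℝ p (EuclideanSpace.single i 1) = (p i).re :=
    (inner_realBasis p (Sum.inl i)).trans (reCoord_inl p i)
  have e2 (i : Fin n) : inner ℝ p (EuclideanSpace.single i Complex.I) = (p i).im :=
    (inner_realBasis p (Sum.inr i)).trans (reCoord_inr p i)
  refine of_hasFDerivAt h' (fun i => ?_) fun i => ?_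
  · have : star (p i) = (p i).re - Complex.I * (p i).im := by
      apply Complex.ext <;> simp
    rw [this]
    simp [e1, e2]
    ring
  · simp [e1, e2]
    linear_combination (φ' : ℂ) * Complex.re_add_im (p i)

end HasWirtinger

variable {S : Set ℝ} {f k f₁ k₁ f₂ k₂ : ℝ → ℝ} {g : TensorField n}

lemma hermMatrix_radialTensor {p : Cn n} (hg : g p = radialTensor n f k p) (i j : Fin n) :
    hermMatrix g p i j = (1 / 2) * (f (radial p) * (1 : Matrix (Fin n) (Fin n) ℂ) i j
      + k (radial p) * (star (p i) * p j)) := by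
  simp only [hermMatrix, of_apply, gram_radialTensor hg, reCoord_inl, reCoord_inr, rotCoord_inl,
    rotCoord_inr]
  by_cases hij : i = j
  · subst hij
    apply Complex.ext <;> simp <;> ring
  · apply Complex.ext <;> simp [one_apply, hij] <;> ring

lemma dotProduct_star (p : Cn n) : (fun i => p i) ⬝ᵥ (fun i => star (p i)) = (radial p : ℂ) := by
  simp only [dotProduct, radial, Complex.ofReal_sum]
  exact Finset.sum_congr rfl fun i _ => by
    rw [Complex.star_def, Complex.mul_conj, Complex.normSq_eq_norm_sq]

lemma hermInv_radialTensor {p : Cn n} (hg : g p = radialTensor n f k p) (hf : f (radial p) ≠ 0)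
    (hE : f (radial p) + k (radial p) * radial p ≠ 0) :
    hermMatrix g p * (hermMatrix g p)⁻¹ = 1 ∧ ∀ i j, hermInv g p i j =
      2 * ((f (radial p) : ℂ)⁻¹ * (1 : Matrix (Fin n) (Fin n) ℂ) j i
        - k (radial p) / (f (radial p) * (f (radial p) + k (radial p) * radial p))
          * (star (p j) * p i)) := by
  have hf' : (f (radial p) : ℂ) ≠ 0 := by exact_mod_cast hf
  have hE' : (f (radial p) + k (radial p) * radial p : ℂ) ≠ 0 := by exact_mod_cast hE
  have hh : hermMatrix g p = (1 / 2 : ℂ) • ((f (radial p) : ℂ) • (1 : Matrix (Fin n) (Fin n) ℂ)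
      + (k (radial p) : ℂ) • vecMulVec (fun i => star (p i)) (fun i => p i)) := by
    ext i j
    rw [hermMatrix_radialTensor hg]
    simp [vecMulVec_apply]
  have hinv : hermMatrix g p * ((2 : ℂ) • ((f (radial p) : ℂ)⁻¹ • (1 : Matrix (Fin n) (Fin n) ℂ)
      - (k (radial p) / (f (radial p) * (f (radial p) + k (radial p) * radial p)) : ℂ)
        • vecMulVec (fun i => star (p i)) (fun i => p i))) = 1 := by
    rw [hh]
    simp only [mul_sub, add_mul, smul_mul_assoc, mul_smul_comm, one_mul, mul_one,
      vecMulVec_mul_vecMulVec, dotProduct_star, vecMulVec_smul]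
    ext a b
    simp only [Matrix.add_apply, Matrix.sub_apply, Matrix.smul_apply, smul_eq_mul]
    field_simp
    ring
  have hinv' := inv_eq_right_inv hinv
  refine ⟨by rw [hinv', hinv], fun i j => ?_⟩
  rw [hermInv, hinv']
  simp [vecMulVec_apply]

lemma hasWirtinger_hermMatrix (hD : IsRadialData S f k f₁ k₁ f₂ k₂)
    (hg : ∀ p, radial p ∈ S → g p = radialTensor n f k p) {p : Cn n} (hp : radial p ∈ S)
    (a b : Fin n) : ∃ d', HasWirtinger (fun q => hermMatrix g q a b) (fun i => (1 / 2) *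
      (f₁ (radial p) * star (p i) * (1 : Matrix (Fin n) (Fin n) ℂ) a b
        + k₁ (radial p) * star (p i) * star (p a) * p b
        + k (radial p) * star (p a) * (1 : Matrix (Fin n) (Fin n) ℂ) b i)) d' p := by
  have h1 := (HasWirtinger.comp_radial (hD.deriv_f _ hp)).mul_const
    ((1 : Matrix (Fin n) (Fin n) ℂ) a b)
  have h2 := (HasWirtinger.comp_radial (hD.deriv_k _ hp)).mul
    ((HasWirtinger.conj_coord a p).mul (HasWirtinger.coord b p))
  have h3 := ((HasWirtinger.const (1 / 2) p).mul (h1.add h2)).congr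
    (g := fun q => hermMatrix g q a b) (by
      filter_upwards [eventually_radial_mem hD.isOpen hp] with q hq
      exact hermMatrix_radialTensor (hg q hq) a b)
  exact ⟨_, h3.of_eq (fun i => by simp only [Pi.zero_apply]; ring) fun i => rfl⟩

lemma chernChristoffel_eq (hD : IsRadialData S f k f₁ k₁ f₂ k₂)
    (hg : ∀ p, radial p ∈ S → g p = radialTensor n f k p) {p : Cn n} (hp : radial p ∈ S)
    (m i l : Fin n) : chernChristoffel g m i l p =
      ((f₁ (radial p) / f (radial p) : ℝ) : ℂ)
          * (star (p i) * (1 : Matrix (Fin n) (Fin n) ℂ) l m)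
        + ((k (radial p) / f (radial p) : ℝ) : ℂ)
          * (star (p l) * (1 : Matrix (Fin n) (Fin n) ℂ) i m)
        + ((k₁ (radial p) / (f (radial p) + k (radial p) * radial p) - f₁ (radial p) *
        (k (radial p) / (f (radial p) * (f (radial p) + k (radial p) * radial p)))
        - k (radial p) *
          (k (radial p) / (f (radial p) * (f (radial p) + k (radial p) * radial p))) : ℝ) : ℂ)
          * (star (p i) * star (p l) * p m) := by
  have hf' : (f (radial p) : ℂ) ≠ 0 := by exact_mod_cast hD.ne_zero _ hp
  have hE' : (f (radial p) + k (radial p) * radial p : ℂ) ≠ 0 := by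
    exact_mod_cast hD.ne_zero' _ hp
  have hd (a b : Fin n) := (hasWirtinger_hermMatrix hD hg hp a b).choose_spec.dz_eq
  simp only [chernChristoffel, (hermInv_radialTensor (hg p hp) (hD.ne_zero _ hp)
    (hD.ne_zero' _ hp)).2, hd]
  have s1 : ∑ q, (1 : Matrix (Fin n) (Fin n) ℂ) q m * (1 : Matrix (Fin n) (Fin n) ℂ) l q
      = (1 : Matrix (Fin n) (Fin n) ℂ) l m := by simp [one_apply]
  have s2 : ∑ q, (1 : Matrix (Fin n) (Fin n) ℂ) q m * p q = p m := by simp [one_apply]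
  have s3 : ∑ q, (1 : Matrix (Fin n) (Fin n) ℂ) q m * (1 : Matrix (Fin n) (Fin n) ℂ) q i
      = (1 : Matrix (Fin n) (Fin n) ℂ) i m := by simp [one_apply, eq_comm]
  have s4 : ∑ q, (1 : Matrix (Fin n) (Fin n) ℂ) l q * star (p q) = star (p l) := by
    simp [one_apply]
  have s5 : ∑ q, p q * star (p q) = radial p := dotProduct_star p
  have s6 : ∑ q, (1 : Matrix (Fin n) (Fin n) ℂ) q i * star (p q) = star (p i) := by
    simp [one_apply]
  push_cast
  generalize hc :
    (k (radial p) / (f (radial p) * (f (radial p) + k (radial p) * radial p)) : ℂ) = c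
  calc _ = ∑ q, ((f (radial p) : ℂ)⁻¹ * f₁ (radial p) * star (p i)
          * ((1 : Matrix (Fin n) (Fin n) ℂ) q m * (1 : Matrix (Fin n) (Fin n) ℂ) l q)
        + (f (radial p) : ℂ)⁻¹ * k₁ (radial p) * star (p i) * star (p l)
          * ((1 : Matrix (Fin n) (Fin n) ℂ) q m * p q)
        + (f (radial p) : ℂ)⁻¹ * k (radial p) * star (p l)
          * ((1 : Matrix (Fin n) (Fin n) ℂ) q m * (1 : Matrix (Fin n) (Fin n) ℂ) q i)
        + (-c * p m * f₁ (radial p) * star (p i))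
          * ((1 : Matrix (Fin n) (Fin n) ℂ) l q * star (p q))
        + (-c * p m * k₁ (radial p) * star (p i) * star (p l)) * (p q * star (p q))
        + (-c * p m * k (radial p) * star (p l))
          * ((1 : Matrix (Fin n) (Fin n) ℂ) q i * star (p q))) :=
        Finset.sum_congr rfl fun q _ => by ring
    _ = _ := by
        simp only [Finset.sum_add_distrib, ← Finset.mul_sum, s1, s2, s3, s4, s5, s6]
        have hcE : (f (radial p) : ℂ)⁻¹ - c * radial p
            = (f (radial p) + k (radial p) * radial p : ℂ)⁻¹ := by
          rw [← hc]
          field_simp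
          ring
        linear_combination (k₁ (radial p) * star (p i) * star (p l) * p m) * hcE

/-- The Chern scalar curvature of a radial metric. It only involves the trace
`Γ^l_{il} = ∂_i log det g`. -/
lemma chernScalarCurvature_eq (hD : IsRadialData S f k f₁ k₁ f₂ k₂)
    (hg : ∀ p, radial p ∈ S → g p = radialTensor n f k p) {p : Cn n} {z E E₁ E₂ : ℝ} (hz : z ∈ S)
    (hpz : radial p = z) (hE : E = f z + k z * z) (hE₁ : E₁ = f₁ z + k₁ z * z + k z)
    (hE₂ : E₂ = f₂ z + k₂ z * z + 2 * k₁ z) :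
    chernScalarCurvature g p = ((-2 *
      (z * ((n - 1) * ((f₂ z * f z - f₁ z ^ 2) / f z ^ 2) + (E₂ * E - E₁ ^ 2) / E ^ 2) / E
        + ((n - 1) * (f₁ z / f z) + E₁ / E) * (E⁻¹ + (n - 1) * (f z)⁻¹)) : ℝ) : ℂ) := by
  have hp : radial p ∈ S := hpz ▸ hz
  have hf0 := hD.ne_zero z hz
  have hE0 := hD.ne_zero' z hz
  have hf := hD.deriv_f z hz
  have hk := hD.deriv_k z hz
  have hf1 := hD.deriv_f₁ z hz
  have hk1 := hD.deriv_k₁ z hz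
  have hid : HasDerivAt (fun t : ℝ => t) 1 z := hasDerivAt_id _
  have hE' : HasDerivAt (fun t => f t + k t * t) E₁ z :=
    (hf.fun_add (hk.fun_mul hid)).congr_deriv (by rw [hE₁]; ring)
  have hE₁' : HasDerivAt (fun t => f₁ t + k₁ t * t + k t) E₂ z :=
    ((hf1.fun_add (hk1.fun_mul hid)).fun_add hk).congr_deriv (by rw [hE₂]; ring)
  have hm := hk.fun_div (hf.fun_mul hE') (mul_ne_zero hf0 hE0)
  have hA := hf1.fun_div hf hf0
  have hK := hk.fun_div hf hf0
  have hR := ((hk1.fun_div hE' hE0).fun_sub (hf1.fun_mul hm)).fun_sub (hk.fun_mul hm)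
  have hχ := (hA.const_mul ((n : ℝ) - 1)).fun_add (hE₁'.fun_div hE' hE0)
  subst hpz
  have hΓ (m i l : Fin n) : DifferentiableAt ℝ (chernChristoffel g m i l) p := by
    have hi := HasWirtinger.conj_coord i p
    have hl := HasWirtinger.conj_coord l p
    have hm := HasWirtinger.coord m p
    refine ((((HasWirtinger.comp_radial hA).mul (hi.mul_const ((1 : Matrix (Fin n) (Fin n) ℂ) l m))).add
      ((HasWirtinger.comp_radial hK).mul (hl.mul_const ((1 : Matrix (Fin n) (Fin n) ℂ) i m)))).add
      ((HasWirtinger.comp_radial hR).mul ((hi.mul hl).mul hm))).congr ?_ |>.differentiableAt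
    filter_upwards [eventually_radial_mem hD.isOpen hp] with q hq
    exact chernChristoffel_eq hD hg hq m i l
  have htrace (i : Fin n) : ∀ᶠ q in nhds p, ∑ l, chernChristoffel g l i l q =
      (((n - 1) * (f₁ (radial q) / f (radial q)) + (f₁ (radial q) + k₁ (radial q) * radial q
        + k (radial q)) / (f (radial q) + k (radial q) * radial q) : ℝ) : ℂ) * star (q i) := by
    filter_upwards [eventually_radial_mem hD.isOpen hp] with q hq
    have hf' : (f (radial q) : ℂ) ≠ 0 := by exact_mod_cast hD.ne_zero _ hq
    have hE' : (f (radial q) + k (radial q) * radial q : ℂ) ≠ 0 := by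
      exact_mod_cast hD.ne_zero' _ hq
    have s1 : ∑ l, (1 : Matrix (Fin n) (Fin n) ℂ) l l = n := by simp
    have s2 : ∑ l, (1 : Matrix (Fin n) (Fin n) ℂ) i l * star (q l) = star (q i) := by
      simp [one_apply]
    have s5 : ∑ l, q l * star (q l) = radial q := dotProduct_star q
    simp only [chernChristoffel_eq hD hg hq]
    push_cast
    generalize hR : (k₁ (radial q) / (f (radial q) + k (radial q) * radial q) - f₁ (radial q) *
      (k (radial q) / (f (radial q) * (f (radial q) + k (radial q) * radial q)))
      - k (radial q) *
        (k (radial q) / (f (radial q) * (f (radial q) + k (radial q) * radial q))) : ℂ) = R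
    calc _ = ∑ l, ((f₁ (radial q) / f (radial q) : ℂ) * star (q i)
            * (1 : Matrix (Fin n) (Fin n) ℂ) l l
          + (k (radial q) / f (radial q) : ℂ) * ((1 : Matrix (Fin n) (Fin n) ℂ) i l * star (q l))
          + R * star (q i) * (q l * star (q l))) :=
          Finset.sum_congr rfl fun l _ => by ring
      _ = _ := by
          simp only [Finset.sum_add_distrib, ← Finset.mul_sum, s1, s2, s5]
          rw [← hR]
          field_simp
          ring
  have hw (i j : Fin n) : ∑ l, dzbar j (chernChristoffel g l i l) p = _ :=
    (HasWirtinger.sum (fun l => (⟨hΓ l i l, fun _ => rfl, fun _ => rfl⟩ :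
      HasWirtinger (chernChristoffel g l i l) _ _ p))).dzbar_eq j |>.symm.trans <|
      (((HasWirtinger.comp_radial hχ).mul (HasWirtinger.conj_coord i p)).congr (htrace i)).dzbar_eq j
  obtain ⟨hmul, hinv⟩ := hermInv_radialTensor (hg p hp) hf0 hE0
  have hΘ (i j : Fin n) : ∑ k, ∑ l, hermInv g p i j * hermInv g p k l * chernCurvature g i j k l p
      = -(hermInv g p i j * ∑ l, dzbar j (chernChristoffel g l i l) p) := by
    have h1 (k m : Fin n) : ∑ l, hermMatrix g p m l * hermInv g p k l
        = (1 : Matrix (Fin n) (Fin n) ℂ) m k := by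
      rw [← hmul, mul_apply]
      rfl
    calc _ = ∑ k, ∑ l, ∑ m, -(hermInv g p i j * (dzbar j (chernChristoffel g m i k) p *
          (hermMatrix g p m l * hermInv g p k l))) := by
          refine Finset.sum_congr rfl fun k _ => Finset.sum_congr rfl fun l _ => ?_
          rw [chernCurvature, ← Finset.sum_neg_distrib, Finset.mul_sum]
          exact Finset.sum_congr rfl fun m _ => by ring
      _ = ∑ k, ∑ m, -(hermInv g p i j * (dzbar j (chernChristoffel g m i k) p *
          (1 : Matrix (Fin n) (Fin n) ℂ) m k)) := by
          refine Finset.sum_congr rfl fun k _ => ?_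
          rw [Finset.sum_comm]
          simp only [Finset.sum_neg_distrib, ← Finset.mul_sum, h1]
      _ = _ := by
          simp only [Finset.sum_neg_distrib, ← Finset.mul_sum]
          simp [one_apply]
  simp only [chernScalarCurvature, hΘ]
  simp only [hw, hinv]
  have s1 : ∑ l, (1 : Matrix (Fin n) (Fin n) ℂ) l l = n := by simp
  have s2 (i : Fin n) : ∑ j, (1 : Matrix (Fin n) (Fin n) ℂ) j i * p j = p i := by
    simp [one_apply]
  have s3 (i : Fin n) : ∑ j, (1 : Matrix (Fin n) (Fin n) ℂ) i j * star (p j) = star (p i) := by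
    simp [one_apply]
  have s4 (i : Fin n) : ∑ j, (1 : Matrix (Fin n) (Fin n) ℂ) j i * (1 : Matrix (Fin n) (Fin n) ℂ) i j
      = (1 : Matrix (Fin n) (Fin n) ℂ) i i := by simp [one_apply]
  have s5 : ∑ l, p l * star (p l) = radial p := dotProduct_star p
  have hcontr (u m χ χ' : ℂ) : ∑ i, ∑ j, -(2 * (u * (1 : Matrix (Fin n) (Fin n) ℂ) j i
      - m * (star (p j) * p i)) * (χ' * p j * star (p i) + χ * (1 : Matrix (Fin n) (Fin n) ℂ) i j))
      = -2 * (u * (χ' * radial p + n * χ) - m * radial p * (χ' * radial p + χ)) := by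
    calc _ = ∑ i, ∑ j, (-2 * u * χ' * star (p i) * ((1 : Matrix (Fin n) (Fin n) ℂ) j i * p j)
          + -2 * u * χ * ((1 : Matrix (Fin n) (Fin n) ℂ) j i * (1 : Matrix (Fin n) (Fin n) ℂ) i j)
          + 2 * m * χ' * p i * star (p i) * (p j * star (p j))
          + 2 * m * χ * p i * ((1 : Matrix (Fin n) (Fin n) ℂ) i j * star (p j))) :=
          Finset.sum_congr rfl fun i _ => Finset.sum_congr rfl fun j _ => by ring
      _ = ∑ i, (-2 * u * χ' * (p i * star (p i))
          + -2 * u * χ * (1 : Matrix (Fin n) (Fin n) ℂ) i i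
          + 2 * m * χ' * radial p * (p i * star (p i)) + 2 * m * χ * (p i * star (p i))) := by
          refine Finset.sum_congr rfl fun i _ => ?_
          simp only [Finset.sum_add_distrib, ← Finset.mul_sum, s2, s3, s4, s5]
          ring
      _ = _ := by
          simp only [Finset.sum_add_distrib, ← Finset.mul_sum, s1, s5]
          ring
  rw [hcontr]
  have hf' : (f (radial p) : ℂ) ≠ 0 := by exact_mod_cast hf0
  have hE'' : (f (radial p) + k (radial p) * radial p : ℂ) ≠ 0 := by exact_mod_cast hE0
  rw [hE, hE₁]
  push_cast
  field_simp
  ring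

end Chern

/-! ### The Klsc and Kähler conditions for radial metrics -/

section Conditions

variable {n : ℕ} {S : Set ℝ} {f k f₁ k₁ f₂ k₂ : ℝ → ℝ} {g : TensorField n}

/-- `S - 2 S_C` in terms of the torsion coefficient `d = f' - k`. -/
lemma scalarCurvature_sub_chern (hD : IsRadialData S f k f₁ k₁ f₂ k₂)
    (hg : ∀ p, radial p ∈ S → g p = radialTensor n f k p) {p : Cn n} {z : ℝ} (hz : z ∈ S)
    (hpz : radial p = z) :
    (scalarCurvature g p : ℂ) - 2 * chernScalarCurvature g p =
      ((-2 * (n - 1) / (f z ^ 2 * (f z + k z * z)) *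
        (2 * f z * (n * (f₁ z - k z) + z * (f₂ z - k₁ z)) + (2 * n - 4) * z * f₁ z * (f₁ z - k z)
          + z * (f₁ z - k z) ^ 2) : ℝ) : ℂ) := by
  rw [chernScalarCurvature_eq hD hg hz hpz rfl rfl rfl, scalarCurvature_eq hD hg hz hpz rfl rfl rfl]
  rw [← Complex.ofReal_ofNat, ← Complex.ofReal_mul, ← Complex.ofReal_sub, Complex.ofReal_inj]
  have hf0 := hD.ne_zero z hz
  have hE0 := hD.ne_zero' z hz
  field_simp
  ring

lemma klsc_iff (hn : 2 ≤ n) (hD : IsRadialData S f k f₁ k₁ f₂ k₂)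
    (hg : ∀ p, radial p ∈ S → g p = radialTensor n f k p) {p : Cn n} {z : ℝ} (hz : z ∈ S)
    (hpz : radial p = z) : (scalarCurvature g p : ℂ) = 2 * chernScalarCurvature g p ↔
      2 * f z * (n * (f₁ z - k z) + z * (f₂ z - k₁ z)) + (2 * n - 4) * z * f₁ z * (f₁ z - k z)
          + z * (f₁ z - k z) ^ 2 = 0 := by
  rw [← sub_eq_zero, scalarCurvature_sub_chern hD hg hz hpz, Complex.ofReal_eq_zero,
    mul_eq_zero, or_iff_right]
  have h2 : (2 : ℝ) ≤ n := by exact_mod_cast hn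
  exact div_ne_zero (mul_ne_zero (by norm_num) (by linarith))
    (mul_ne_zero (pow_ne_zero _ (hD.ne_zero z hz)) (hD.ne_zero' z hz))

lemma inner_I_smul_I_smul (v w : Cn n) :
    inner ℝ (Complex.I • v) (Complex.I • w) = inner ℝ v w := by
  simp [real_inner_eq_sum, add_comm]

lemma inner_I_smul_right (v w : Cn n) :
    inner ℝ v (Complex.I • w) = -inner ℝ (Complex.I • v) w := by
  simp only [real_inner_eq_sum, ← Finset.sum_neg_distrib]
  exact Finset.sum_congr rfl fun i _ => by simp

lemma inner_I_smul_self (v : Cn n) : inner ℝ (Complex.I • v) v = 0 := by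
  have h := real_inner_comm (Complex.I • v) v
  rw [inner_I_smul_right] at h
  linarith

/-- `dω = 2 d(𝐳) x ∧ ω₀` with the torsion coefficient `d = f' - k`, the form `x = ⟨p, ·⟩` and the
Euclidean Kähler form `ω₀`. -/
lemma dAssocForm_eq (hD : IsRadialData S f k f₁ k₁ f₂ k₂)
    (hg : ∀ p, radial p ∈ S → g p = radialTensor n f k p) {p : Cn n} (hp : radial p ∈ S)
    (u v w : Cn n) : dAssocForm g p u v w = 2 * (f₁ (radial p) - k (radial p)) *
      (inner ℝ p u * inner ℝ (Complex.I • v) w + inner ℝ p v * inner ℝ (Complex.I • w) u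
        + inner ℝ p w * inner ℝ (Complex.I • u) v) := by
  have hder (u v w : Cn n) : fderiv ℝ (fun q => assocForm g q v w) p u =
      2 * f₁ (radial p) * inner ℝ p u * inner ℝ (Complex.I • v) w
      + 2 * k₁ (radial p) * inner ℝ p u * (inner ℝ p v * inner ℝ (Complex.I • p) w
        - inner ℝ (Complex.I • p) v * inner ℝ p w)
      + k (radial p) * (inner ℝ u v * inner ℝ (Complex.I • p) w
        + inner ℝ p v * inner ℝ (Complex.I • u) w - inner ℝ (Complex.I • u) v * inner ℝ p w
        - inner ℝ (Complex.I • p) v * inner ℝ u w) := by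
    have hf := (hD.deriv_f _ hp).comp_hasFDerivAt p (hasFDerivAt_radial p)
    have hk := (hD.deriv_k _ hp).comp_hasFDerivAt p (hasFDerivAt_radial p)
    have hx (v : Cn n) : HasFDerivAt (fun q : Cn n => inner ℝ q v) (innerSL ℝ v) p := by
      exact (innerSL ℝ v).hasFDerivAt.congr_of_eventuallyEq
        (Filter.Eventually.of_forall fun q => real_inner_comm _ _)
    have hy (v : Cn n) : HasFDerivAt (fun q : Cn n => inner ℝ (Complex.I • q) v)
        (-innerSL ℝ (Complex.I • v)) p := by
      have h := (hx (Complex.I • v)).neg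
      refine h.congr_of_eventuallyEq (Filter.Eventually.of_forall fun q => ?_)
      simp [inner_I_smul_right]
    have h := (hf.mul_const (inner ℝ (Complex.I • v) w)).add
      (hk.mul (((hx v).mul (hy w)).sub ((hy v).mul (hx w))))
    have h' := h.congr_of_eventuallyEq (f₁ := fun q => assocForm g q v w) (by
      filter_upwards [eventually_radial_mem hD.isOpen hp] with q hq
      rw [assocForm, hg q hq, radialTensor_apply, inner_I_smul_right q v, inner_I_smul_I_smul]
      simp only [Pi.add_apply, Pi.mul_apply, Pi.sub_apply, Function.comp]
      ring)
    rw [h'.fderiv]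
    have e1 (v : Cn n) : inner ℝ v u = inner ℝ u v := real_inner_comm _ _
    simp only [_root_.add_apply, _root_.sub_apply, _root_.smul_apply, _root_.neg_apply,
      innerSL_apply_apply, Function.comp, smul_eq_mul, nsmul_eq_mul, e1, inner_I_smul_right u]
    simp
    ring
  have swap (v w : Cn n) : (inner ℝ (Complex.I • w) v : ℝ) = -inner ℝ (Complex.I • v) w := by
    rw [real_inner_comm, inner_I_smul_right]
  simp only [dAssocForm, hder]
  rw [real_inner_comm v u, real_inner_comm w u, real_inner_comm w v, swap u v, swap u w, swap v w]
  ring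

end Conditions

/-! ### Unitary invariant Hermitian metrics -/

section Invariant

variable {n : ℕ} {α : ℝ} {β : EReal}

lemma isOpen_radialInterval (α : ℝ) (β : EReal) : IsOpen (radialInterval α β) :=
  isOpen_Ioi.inter (isOpen_Iio.preimage continuous_coe_real_ereal)

lemma ordConnected_radialInterval (α : ℝ) (β : EReal) : (radialInterval α β).OrdConnected :=
  ⟨fun _ hx _ hy _ hz => ⟨hx.1.trans_le hz.1, (EReal.coe_le_coe_iff.2 hz.2).trans_lt hy.2⟩⟩

lemma radialInterval_nonempty (h : (α : EReal) < β) : (radialInterval α β).Nonempty := by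
  obtain ⟨t, h1, h2⟩ := EReal.lt_iff_exists_real_btwn.1 h
  exact ⟨t, EReal.coe_lt_coe_iff.1 h1, h2⟩

lemma pos_of_mem_radialInterval (hα : 0 ≤ α) {t : ℝ} (ht : t ∈ radialInterval α β) : 0 < t :=
  hα.trans_lt ht.1

lemma inner_I_smul_left_eq_im (p v : Cn n) :
    inner ℝ (Complex.I • p) v = (inner ℂ p v : ℂ).im := by
  simp [real_inner_eq_re]

lemma dSqrtRadial_apply {p : Cn n} (hp : 0 < radial p) (v : Cn n) :
    dSqrtRadial p v = inner ℝ p v / √(radial p) := by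
  rw [dSqrtRadial, ((hasFDerivAt_radial p).sqrt hp.ne').fderiv]
  have : √(radial p) ≠ 0 := (Real.sqrt_pos.2 hp).ne'
  simp
  field_simp

lemma hopfForm_apply (p v : Cn n) :
    hopfForm p v = (radial p)⁻¹ * inner ℝ (Complex.I • p) v := by
  rw [inner_I_smul_left_eq_im]
  rfl

/-- The tensor `E ((d√𝐳)² + 𝐳 h) + 𝐳 F g_{ℂℙ}` in terms of `radialTensor`. -/
lemma radialTensor_eq_blocks {p : Cn n} (hp : 0 < radial p) (E F : ℝ → ℝ) :
    E (radial p) • (dSqrtRadialSq n p + radial p • hopfMetric n p)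
      + (radial p * F (radial p)) • fubiniStudy n p
      = radialTensor n F (fun t => (E t - F t) / t) p := by
  ext v w
  have h1 : dSqrtRadialSq n p v w = inner ℝ p v * inner ℝ p w / radial p := by
    change dSqrtRadial p v * dSqrtRadial p w = _
    rw [dSqrtRadial_apply hp, dSqrtRadial_apply hp, div_mul_div_comm, Real.mul_self_sqrt hp.le]
  have h2 : hopfMetric n p v w
      = inner ℝ (Complex.I • p) v * inner ℝ (Complex.I • p) w / radial p ^ 2 := by
    change hopfForm p v * hopfForm p w = _
    rw [hopfForm_apply, hopfForm_apply]
    field_simp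
  have h3 : fubiniStudy n p v w
      = (radial p)⁻¹ * (inner ℝ v w - dSqrtRadialSq n p v w) - hopfMetric n p v w := rfl
  rw [radialTensor_apply]
  change E (radial p) * (dSqrtRadialSq n p v w + radial p * hopfMetric n p v w)
      + (radial p * F (radial p)) * fubiniStudy n p v w = _
  rw [h3, h1, h2]
  field_simp
  ring

lemma contDiffOn_radialTensor {S : Set ℝ} {f k : ℝ → ℝ}
    (hf : ContDiffOn ℝ ∞ f S) (hk : ContDiffOn ℝ ∞ k S) :
    ContDiffOn ℝ ∞ (radialTensor n f k) {p : Cn n | radial p ∈ S} := by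
  have hrad : ContDiff ℝ ∞ (radial (n := n)) := by
    rw [show radial (n := n) = fun p => ‖p‖ ^ 2 from funext radial_eq_norm_sq]
    exact contDiff_norm_sq ℝ
  have hmaps : Set.MapsTo (radial (n := n)) {p : Cn n | radial p ∈ S} S := fun p hp => hp
  have hx (v : Cn n) : ContDiff ℝ ∞ (fun p : Cn n => (inner ℝ p v : ℝ)) :=
    contDiff_id.inner ℝ contDiff_const
  have hy (v : Cn n) : ContDiff ℝ ∞ (fun p : Cn n => (inner ℝ (Complex.I • p) v : ℝ)) :=
    (contDiff_const_smul Complex.I).inner ℝ contDiff_const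
  refine contDiffOn_clm_apply.2 fun v => contDiffOn_clm_apply.2 fun w => ?_
  simp only [radialTensor_apply]
  exact ((hf.comp hrad.contDiffOn hmaps).mul contDiffOn_const).add
    ((hk.comp hrad.contDiffOn hmaps).mul
      (((hx v).mul (hx w)).add ((hy v).mul (hy w))).contDiffOn)

lemma inner_sq_add_inner_sq_le (p v : Cn n) :
    inner ℝ p v ^ 2 + inner ℝ (Complex.I • p) v ^ 2 ≤ radial p * ‖v‖ ^ 2 := by
  rw [real_inner_eq_re, inner_I_smul_left_eq_im, radial_eq_norm_sq, ← mul_pow]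
  have h := norm_inner_le_norm (𝕜 := ℂ) p v
  calc _ = ‖(inner ℂ p v : ℂ)‖ ^ 2 := by
        rw [← Complex.normSq_eq_norm_sq, Complex.normSq_apply]; ring
    _ ≤ _ := by gcongr

lemma isHermitianMetricOn_radialTensor {f k : ℝ → ℝ} {g : TensorField n}
    (hf : ContDiffOn ℝ ∞ f (radialInterval α β)) (hk : ContDiffOn ℝ ∞ k (radialInterval α β))
    (hf0 : ∀ t ∈ radialInterval α β, 0 < f t) (hE0 : ∀ t ∈ radialInterval α β, 0 < f t + k t * t)
    (hg : ∀ p, radial p ∈ radialInterval α β → g p = radialTensor n f k p) :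
    IsHermitianMetricOn (annulus n α β) g where
  smooth := (contDiffOn_radialTensor hf hk).congr hg
  symm p hp v w := by
    rw [hg p hp, radialTensor_apply, radialTensor_apply, real_inner_comm]
    ring
  pos p hp v hv := by
    rw [hg p hp, radialTensor_apply, real_inner_self_eq_norm_sq]
    have h1 := inner_sq_add_inner_sq_le p v
    have h2 := hf0 _ hp
    have h3 := hE0 _ hp
    have h4 : 0 < ‖v‖ ^ 2 := by positivity
    rcases le_total 0 (k (radial p)) with h | h
    · have : 0 ≤ k (radial p) * (inner ℝ p v * inner ℝ p v
          + inner ℝ (Complex.I • p) v * inner ℝ (Complex.I • p) v) :=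
        mul_nonneg h (add_nonneg (mul_self_nonneg _) (mul_self_nonneg _))
      nlinarith
    · have := mul_le_mul_of_nonpos_left h1 h
      nlinarith [mul_pos h3 h4]
  hermitian p hp v w := by
    rw [hg p hp, radialTensor_apply, radialTensor_apply, inner_I_smul_I_smul, inner_I_smul_I_smul,
      inner_I_smul_I_smul, inner_I_smul_right, inner_I_smul_right]
    ring

lemma radial_map (U : Cn n ≃ₗᵢ[ℂ] Cn n) (p : Cn n) : radial (U p) = radial p := by
  rw [radial_eq_norm_sq, radial_eq_norm_sq, U.norm_map]

lemma isUnitaryInvariantOn_radialTensor {f k : ℝ → ℝ} {g : TensorField n}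
    (hg : ∀ p, radial p ∈ radialInterval α β → g p = radialTensor n f k p) :
    IsUnitaryInvariantOn (annulus n α β) g := by
  intro U p hp v w
  have hU : radial (U p) = radial p := radial_map U p
  have hin (v w : Cn n) : inner ℝ (U v) (U w) = inner ℝ v w := by
    rw [real_inner_eq_re, real_inner_eq_re, U.inner_map_map]
  rw [hg p hp, hg (U p) (by rw [hU]; exact hp), radialTensor_apply, radialTensor_apply, hU,
    ← map_smul, hin, hin, hin, hin, hin]

/-- `U(n)` acts transitively on pairs of orthonormal vectors. -/
lemma exists_unitary_map_single {i j : Fin n} (hij : i ≠ j) {a b : Cn n} (ha : ‖a‖ = 1)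
    (hb : ‖b‖ = 1) (hab : inner ℂ a b = 0) : ∃ U : Cn n ≃ₗᵢ[ℂ] Cn n,
      U (EuclideanSpace.single i 1) = a ∧ U (EuclideanSpace.single j 1) = b := by
  classical
  have hba : inner ℂ b a = 0 := inner_eq_zero_symm.1 hab
  have hon : Orthonormal ℂ (({i, j} : Set (Fin n)).domRestrict fun l => if l = i then a else b) := by
    constructor
    · rintro ⟨l, rfl | rfl⟩ <;> simp [Set.domRestrict, ha, hb, hij.symm]
    · rintro ⟨l, rfl | rfl⟩ ⟨m, rfl | rfl⟩ h <;>
        simp_all [Set.domRestrict, hij.symm]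
  obtain ⟨B, hB⟩ := hon.exists_orthonormalBasis_extension_of_card_eq (by simp)
  refine ⟨B.repr.symm, ?_, ?_⟩
  · rw [B.repr_symm_single, hB i (by simp), if_pos rfl]
  · rw [B.repr_symm_single, hB j (by simp), if_neg hij.symm]

lemma exists_unitary_map_single_left (i : Fin n) {a : Cn n} (ha : ‖a‖ = 1) :
    ∃ U : Cn n ≃ₗᵢ[ℂ] Cn n, U (EuclideanSpace.single i 1) = a := by
  have hon : Orthonormal ℂ (({i} : Set (Fin n)).domRestrict fun _ => a) := by
    constructor
    · rintro ⟨l, rfl⟩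
      simpa [Set.domRestrict] using ha
    · rintro ⟨l, rfl⟩ ⟨m, rfl⟩ h
      exact absurd rfl h
  obtain ⟨B, hB⟩ := hon.exists_orthonormalBasis_extension_of_card_eq (by simp)
  exact ⟨B.repr.symm, by rw [B.repr_symm_single, hB i (by simp)]⟩

/-- The value of `g` at the point `√t e_i` on the unit vector `e_i`; for an invariant metric, the
coefficient along the complex line through the base point. -/
def lineCoeff (g : TensorField n) (i : Fin n) (t : ℝ) : ℝ :=
  g (√t • EuclideanSpace.single i 1) (EuclideanSpace.single i 1) (EuclideanSpace.single i 1)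

/-- The value of `g` at the point `√t e_i` on the unit vector `e_j`; for an invariant metric and
`j ≠ i`, the coefficient orthogonal to the complex line through the base point. -/
def orthCoeff (g : TensorField n) (i j : Fin n) (t : ℝ) : ℝ :=
  g (√t • EuclideanSpace.single i 1) (EuclideanSpace.single j 1) (EuclideanSpace.single j 1)

lemma radial_sqrt_smul_single (i : Fin n) {t : ℝ} (ht : 0 ≤ t) :
    radial (√t • EuclideanSpace.single i (1 : ℂ)) = t := by
  rw [radial_eq_norm_sq, norm_smul]
  simp [abs_of_nonneg, Real.sqrt_nonneg, Real.sq_sqrt ht]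

/-- The values of an invariant metric on `p` and on vectors orthogonal to the complex line of `p`.
The cross term vanishes because some unitary map fixes `p` and reverses `w`. -/
lemma invariant_apply_of_orthogonal (hα : 0 ≤ α) {g : TensorField n}
    (hU : IsUnitaryInvariantOn (annulus n α β) g) {i j : Fin n} (hij : i ≠ j) {p : Cn n}
    (hp : radial p ∈ radialInterval α β) {w : Cn n} (hw : inner ℂ p w = 0) :
    g p p p = radial p * lineCoeff g i (radial p) ∧
      g p w w = ‖w‖ ^ 2 * orthCoeff g i j (radial p) ∧ g p p w = 0 := by
  have hz := pos_of_mem_radialInterval hα hp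
  set r := √(radial p) with hr
  have hr0 : 0 < r := Real.sqrt_pos.2 hz
  have hrsq : r ^ 2 = radial p := Real.sq_sqrt hz.le
  have hpr : ‖p‖ = r := by rw [hr, radial_eq_norm_sq, Real.sqrt_sq (norm_nonneg p)]
  set q : Cn n := r • EuclideanSpace.single i 1 with hq
  have hqA : q ∈ annulus n α β := by
    change radial q ∈ radialInterval α β
    rw [hq, hr, radial_sqrt_smul_single i hz.le]
    exact hp
  -- transport from `q` for a unit vector `b` orthogonal to `p`
  have key (b : Cn n) (hb : ‖b‖ = 1) (hpb : inner ℂ p b = 0) :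
      g p p p = r ^ 2 * lineCoeff g i (radial p) ∧ g p b b = orthCoeff g i j (radial p) ∧
        g p p b = r * g q (EuclideanSpace.single i 1) (EuclideanSpace.single j 1) := by
    obtain ⟨U, hUi, hUj⟩ := exists_unitary_map_single hij (a := r⁻¹ • p) (b := b)
      (by rw [norm_smul, hpr, Real.norm_of_nonneg (by positivity), inv_mul_cancel₀ hr0.ne']) hb
      (by rw [← Complex.coe_smul, inner_smul_left, hpb, mul_zero])
    have hUq : U q = p := by
      rw [hq, ← Complex.coe_smul, map_smul, hUi, Complex.coe_smul, smul_smul,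
        mul_inv_cancel₀ hr0.ne', one_smul]
    have h1 := hU U q hqA (EuclideanSpace.single i 1) (EuclideanSpace.single i 1)
    have h2 := hU U q hqA (EuclideanSpace.single j 1) (EuclideanSpace.single j 1)
    have h3 := hU U q hqA (EuclideanSpace.single i 1) (EuclideanSpace.single j 1)
    rw [hUq, hUi] at h1 h3
    rw [hUq, hUj] at h2
    rw [hUj] at h3
    simp only [map_smul, _root_.smul_apply, smul_eq_mul] at h1 h3
    refine ⟨?_, h2, ?_⟩
    · rw [lineCoeff, ← hr, ← hq, ← h1]
      field_simp
    · rw [← h3]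
      field_simp
  have cross (b : Cn n) (hb : ‖b‖ = 1) (hpb : inner ℂ p b = 0) : g p p b = 0 := by
    have h1 := (key b hb hpb).2.2
    have h2 := (key (-b) (by rwa [norm_neg]) (by rw [inner_neg_right, hpb, neg_zero])).2.2
    rw [map_neg] at h2
    linarith
  refine ⟨?_, ?_⟩
  · obtain ⟨U, hUi⟩ := exists_unitary_map_single_left i (a := r⁻¹ • p)
      (by rw [norm_smul, hpr, Real.norm_of_nonneg (by positivity), inv_mul_cancel₀ hr0.ne'])
    have hpU : p = (r : ℂ) • U (EuclideanSpace.single i 1) := by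
      rw [hUi, Complex.coe_smul, smul_smul, mul_inv_cancel₀ hr0.ne', one_smul]
    refine hrsq ▸ (key (U (EuclideanSpace.single j 1)) (by simp) ?_).1
    rw [hpU, inner_smul_left, U.inner_map_map, EuclideanSpace.inner_single_left]
    simp [hij]
  · by_cases hw0 : w = 0
    · simp [hw0]
    have hw1 : ‖w‖ ≠ 0 := norm_ne_zero_iff.2 hw0
    have hb : ‖(‖w‖⁻¹ • w)‖ = 1 := by
      rw [norm_smul, norm_inv, norm_norm, inv_mul_cancel₀ hw1]
    have hpb : inner ℂ p (‖w‖⁻¹ • w) = 0 := by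
      rw [← Complex.coe_smul, inner_smul_right, hw, mul_zero]
    have h1 := (key _ hb hpb).2.1
    have h2 := cross _ hb hpb
    simp only [map_smul, _root_.smul_apply, smul_eq_mul] at h1 h2
    refine ⟨?_, ?_⟩
    · rw [← h1]
      field_simp
    · exact (mul_eq_zero.1 h2).resolve_left (inv_ne_zero hw1)

end Invariant

section Classification

variable {n : ℕ} {α : ℝ} {β : EReal} {g : TensorField n}

/-- A `U(n)`-invariant Hermitian metric is radial. -/
lemma eq_radialTensor_of_invariant (hα : 0 ≤ α) (hH : IsHermitianMetricOn (annulus n α β) g)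
    (hU : IsUnitaryInvariantOn (annulus n α β) g) {i j : Fin n} (hij : i ≠ j) {p : Cn n}
    (hp : radial p ∈ radialInterval α β) :
    g p = radialTensor n (orthCoeff g i j) (fun t => (lineCoeff g i t - orthCoeff g i j t) / t) p := by
  have hz := pos_of_mem_radialInterval hα hp
  have hpp : inner ℝ p p = radial p := (radial_eq_inner p).symm
  have hIp : inner ℝ p (Complex.I • p) = 0 := by
    rw [real_inner_comm, inner_I_smul_self]
  have hsymm := hH.symm p hp
  have hI : ∀ v, g p (Complex.I • p) (Complex.I • v) = g p p v := hH.hermitian p hp p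
  have hII (v : Cn n) : Complex.I • Complex.I • v = -v := by
    rw [smul_smul, Complex.I_mul_I, neg_one_smul]
  have hI' (v : Cn n) : g p (Complex.I • p) v = -g p p (Complex.I • v) := by
    rw [← hI, hII, map_neg, neg_neg]
  have hpI : g p p (Complex.I • p) = 0 := by
    have h1 := hI' p
    rw [hsymm] at h1
    linarith
  -- the quadratic forms agree, by splitting off the component in the complex line of `p`
  have hquad (v : Cn n) : g p v v = radialTensor n (orthCoeff g i j)
      (fun t => (lineCoeff g i t - orthCoeff g i j t) / t) p v v := by
    set a := inner ℝ p v / radial p with ha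
    set b := inner ℝ (Complex.I • p) v / radial p with hb
    have ha' : inner ℝ p v = a * radial p := by rw [ha]; field_simp
    have hb' : inner ℝ (Complex.I • p) v = b * radial p := by rw [hb]; field_simp
    set w := v - a • p - b • (Complex.I • p) with hw
    have hv : v = w + a • p + b • (Complex.I • p) := by rw [hw]; abel
    have hw1 : inner ℝ p w = 0 := by
      rw [hw, inner_sub_right, inner_sub_right, inner_smul_right, inner_smul_right, hpp, hIp, ha']
      ring
    have hw2 : inner ℝ (Complex.I • p) w = 0 := by
      rw [hw, inner_sub_right, inner_sub_right, inner_smul_right, inner_smul_right,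
        inner_I_smul_I_smul, hpp, inner_I_smul_self, hb']
      ring
    have hpw : inner ℂ p w = 0 := by
      apply Complex.ext
      · rw [← real_inner_eq_re, hw1, Complex.zero_re]
      · rw [← inner_I_smul_left_eq_im, hw2, Complex.zero_im]
    have hpIw : inner ℂ p (Complex.I • w) = 0 := by rw [inner_smul_right, hpw, mul_zero]
    obtain ⟨e1, e2, e3⟩ := invariant_apply_of_orthogonal hα hU hij hp hpw
    obtain ⟨-, -, e4⟩ := invariant_apply_of_orthogonal hα hU hij hp hpIw
    have e5 : g p (Complex.I • p) w = 0 := by rw [hI', e4, neg_zero]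
    have e6 : g p (Complex.I • p) (Complex.I • p) = g p p p := hI p
    have e7 : inner ℝ w p = 0 := by rw [real_inner_comm, hw1]
    have e8 : inner ℝ w (Complex.I • p) = 0 := by rw [real_inner_comm, hw2]
    have hvv : inner ℝ v v = ‖w‖ ^ 2 + a ^ 2 * radial p + b ^ 2 * radial p := by
      rw [hv]
      simp only [inner_add_left, inner_add_right, real_inner_smul_left, real_inner_smul_right,
        hpp, hIp, inner_I_smul_self, inner_I_smul_I_smul, hw1, hw2, e7, e8,
        real_inner_self_eq_norm_sq w]
      ring
    have hg : g p v v = g p w w + a ^ 2 * g p p p + b ^ 2 * g p p p := by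
      rw [hv]
      simp only [map_add, map_smul, _root_.add_apply, _root_.smul_apply, smul_eq_mul,
        hsymm w p, hsymm w (Complex.I • p), hsymm (Complex.I • p) p, hpI, e3, e5, e6]
      ring
    rw [radialTensor_apply, hg, hvv, ha', hb', e1, e2]
    field_simp
    ring
  ext v w
  have h1 := hquad (v + w)
  have h2 : radialTensor n (orthCoeff g i j)
      (fun t => (lineCoeff g i t - orthCoeff g i j t) / t) p w v = radialTensor n (orthCoeff g i j)
      (fun t => (lineCoeff g i t - orthCoeff g i j t) / t) p v w := by
    rw [radialTensor_apply, radialTensor_apply, real_inner_comm]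
    ring
  simp only [map_add, _root_.add_apply, hsymm w v, hquad v, hquad w, h2] at h1
  linarith

lemma sqrt_smul_single_mem_annulus (hα : 0 ≤ α) (i : Fin n) {t : ℝ}
    (ht : t ∈ radialInterval α β) : √t • EuclideanSpace.single i (1 : ℂ) ∈ annulus n α β := by
  change radial _ ∈ radialInterval α β
  rwa [radial_sqrt_smul_single i (pos_of_mem_radialInterval hα ht).le]

lemma contDiffOn_apply_sqrt_smul_single (hα : 0 ≤ α) (hg : ContDiffOn ℝ ∞ g (annulus n α β))
    (i : Fin n) (v : Cn n) :
    ContDiffOn ℝ ∞ (fun t => g (√t • EuclideanSpace.single i 1) v v) (radialInterval α β) := by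
  have h1 : ContDiffOn ℝ ∞ (fun t : ℝ => √t • EuclideanSpace.single i (1 : ℂ))
      (radialInterval α β) := fun t ht =>
    ((Real.contDiffAt_sqrt (pos_of_mem_radialInterval hα ht).ne').smul
      contDiffAt_const).contDiffWithinAt
  have h2 := hg.comp h1 fun t ht => sqrt_smul_single_mem_annulus hα i ht
  exact (contDiffOn_clm_apply.1 ((contDiffOn_clm_apply.1 h2) v)) v

lemma isRadialData_of_contDiffOn {S : Set ℝ} (hS : IsOpen S) {f k : ℝ → ℝ}
    (hf : ContDiffOn ℝ ∞ f S) (hk : ContDiffOn ℝ ∞ k S) (hf0 : ∀ t ∈ S, 0 < f t)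
    (hE0 : ∀ t ∈ S, 0 < f t + k t * t) :
    IsRadialData S f k (deriv f) (deriv k) (deriv (deriv f)) (deriv (deriv k)) := by
  have hd {φ : ℝ → ℝ} (hφ : ContDiffOn ℝ ∞ φ S) : ∀ t ∈ S, HasDerivAt φ (deriv φ t) t :=
    fun t ht => (((contDiffOn_infty_iff_deriv_of_isOpen hS).1 hφ).1.differentiableAt
      (hS.mem_nhds ht)).hasDerivAt
  have hd' {φ : ℝ → ℝ} (hφ : ContDiffOn ℝ ∞ φ S) : ContDiffOn ℝ ∞ (deriv φ) S :=
    ((contDiffOn_infty_iff_deriv_of_isOpen hS).1 hφ).2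
  exact ⟨hS, fun t ht => (hf0 t ht).ne', fun t ht => (hE0 t ht).ne', hd hf, hd hk, hd (hd' hf),
    hd (hd' hk)⟩

/-! ### The torsion function and its differential equation -/

/-- The torsion function `u = 𝐳ⁿ fⁿ⁻² (f' - k)` for `n ≥ 2`, which vanishes exactly where `dω`
does. -/
def torsion (n : ℕ) (f k : ℝ → ℝ) (t : ℝ) : ℝ := t ^ n * f t ^ (n - 2) * (deriv f t - k t)

variable {S : Set ℝ} {f k : ℝ → ℝ}

lemma torsion_ne_zero_iff
    (hD : IsRadialData S f k (deriv f) (deriv k) (deriv (deriv f)) (deriv (deriv k))) {t : ℝ}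
    (ht : t ∈ S) (ht0 : t ≠ 0) : torsion n f k t ≠ 0 ↔ deriv f t - k t ≠ 0 := by
  rw [torsion, mul_ne_zero_iff]
  exact and_iff_right (mul_ne_zero (pow_ne_zero _ ht0) (pow_ne_zero _ (hD.ne_zero t ht)))

lemma differentiableAt_torsion
    (hD : IsRadialData S f k (deriv f) (deriv k) (deriv (deriv f)) (deriv (deriv k))) {t : ℝ}
    (ht : t ∈ S) : DifferentiableAt ℝ (torsion n f k) t :=
  ((differentiableAt_id.pow n).mul ((hD.deriv_f t ht).differentiableAt.pow (n - 2))).mul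
    ((hD.deriv_f₁ t ht).differentiableAt.sub (hD.deriv_k t ht).differentiableAt)

/-- The Klsc condition is the Bernoulli equation `2 𝐳ⁿ fⁿ⁻¹ u' = -u²` for the torsion function. -/
lemma klsc_iff_torsion (hn : 2 ≤ n)
    (hD : IsRadialData S f k (deriv f) (deriv k) (deriv (deriv f)) (deriv (deriv k)))
    (hg : ∀ p, radial p ∈ S → g p = radialTensor n f k p) {p : Cn n} (hp : radial p ∈ S)
    (hp0 : 0 < radial p) : (scalarCurvature g p : ℂ) = 2 * chernScalarCurvature g p ↔
      2 * radial p ^ n * f (radial p) ^ (n - 1) * deriv (torsion n f k) (radial p)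
        = -torsion n f k (radial p) ^ 2 := by
  rw [klsc_iff hn hD hg hp rfl]
  generalize radial p = t at *
  obtain ⟨m, rfl⟩ : ∃ m, n = m + 2 := ⟨n - 2, by omega⟩
  have h1 := ((hasDerivAt_pow (m + 2) t).fun_mul ((hD.deriv_f t hp).fun_pow m)).fun_mul
    ((hD.deriv_f₁ t hp).fun_sub (hD.deriv_k t hp))
  have h2 : deriv (torsion (m + 2) f k) t = _ := h1.deriv
  have hf := hD.ne_zero t hp
  have key : 2 * t ^ (m + 2) * f t ^ (m + 1) * deriv (torsion (m + 2) f k) t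
      + torsion (m + 2) f k t ^ 2 = t ^ (2 * m + 3) * f t ^ (2 * m) *
      (2 * f t * (((m + 2 : ℕ) : ℝ) * (deriv f t - k t) + t * (deriv (deriv f) t - deriv k t))
        + (2 * ((m + 2 : ℕ) : ℝ) - 4) * t * deriv f t * (deriv f t - k t)
        + t * (deriv f t - k t) ^ 2) := by
    rw [h2, torsion]
    rcases m with _ | m
    · simp
      ring
    · push_cast
      ring
  have hne : t ^ (2 * m + 3) * f t ^ (2 * m) ≠ 0 :=
    mul_ne_zero (pow_ne_zero _ hp0.ne') (pow_ne_zero _ hf)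
  rw [show m + 2 - 1 = m + 1 from rfl, ← sub_eq_zero (b := -_), sub_neg_eq_add, key, mul_eq_zero,
    or_iff_right hne]

/-- A solution of `a u' = -u²` on an interval vanishes everywhere if it vanishes somewhere. -/
lemma eq_zero_of_bernoulli {S : Set ℝ} (hS : IsOpen S) (hc : S.OrdConnected) {a u : ℝ → ℝ}
    (ha : ContinuousOn a S) (ha0 : ∀ t ∈ S, a t ≠ 0) (hu : ∀ t ∈ S, DifferentiableAt ℝ u t)
    (hode : ∀ t ∈ S, a t * deriv u t = -u t ^ 2) {t₀ : ℝ} (ht₀ : t₀ ∈ S) (hu₀ : u t₀ = 0) {t : ℝ}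
    (ht : t ∈ S) : u t = 0 := by
  obtain ⟨l, r, hmem, hlr⟩ : ∃ l r, t₀ ∈ Set.Ioo l r ∧ t ∈ Set.Ioo l r ∧ Set.Icc l r ⊆ S := by
    have hmin : min t₀ t ∈ S := by rcases min_choice t₀ t with h | h <;> rwa [h]
    have hmax : max t₀ t ∈ S := by rcases max_choice t₀ t with h | h <;> rwa [h]
    obtain ⟨ε, hε, hε'⟩ := Metric.isOpen_iff.1 hS _ hmin
    obtain ⟨δ, hδ, hδ'⟩ := Metric.isOpen_iff.1 hS _ hmax
    refine ⟨min t₀ t - ε / 2, max t₀ t + δ / 2, ⟨?_, ?_⟩, ⟨?_, ?_⟩, hc.out (hε' ?_) (hδ' ?_)⟩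
    · linarith [min_le_left t₀ t]
    · linarith [le_max_left t₀ t]
    · linarith [min_le_right t₀ t]
    · linarith [le_max_right t₀ t]
    · rw [Metric.mem_ball, Real.dist_eq, abs_lt]; constructor <;> linarith
    · rw [Metric.mem_ball, Real.dist_eq, abs_lt]; constructor <;> linarith
  obtain ⟨htm, hsub⟩ := hlr
  have hucont : ContinuousOn u S := fun s hs => (hu s hs).continuousAt.continuousWithinAt
  obtain ⟨M, hM⟩ := (isCompact_Icc (a := l) (b := r)).exists_bound_of_continuousOn
    (((hucont.neg).div ha ha0).mono hsub)
  -- `u` and `0` both solve the linear equation `v' = (-u / a) v`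
  refine ODE_solution_unique_of_mem_Ioo (v := fun s x => (-u s / a s) * x) (K := M.toNNReal)
    (s := fun _ => Set.univ) (f := u) (g := fun _ => 0) (t₀ := t₀) (a := l) (b := r)
    (fun s hs => ?_) hmem (fun s hs => ⟨?_, trivial⟩) (fun s hs => ⟨?_, trivial⟩) hu₀ htm
  · refine LipschitzOnWith.of_dist_le_mul fun x _ y _ => ?_
    rw [Real.dist_eq, Real.dist_eq, ← mul_sub, abs_mul]
    gcongr
    exact (hM s (Set.Ioo_subset_Icc_self hs)).trans (Real.le_coe_toNNReal M)
  · have hsS := hsub (Set.Ioo_subset_Icc_self hs)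
    refine (hu s hsS).hasDerivAt.congr_deriv ?_
    have h1 := hode s hsS
    have h2 := ha0 s hsS
    field_simp
    linarith
  · simpa using hasDerivAt_const s (0 : ℝ)

end Classification

/-! ### Admissible pairs and the moduli space -/

section Moduli

variable {n : ℕ} {α : ℝ} {β : EReal} {I : (ℝ → ℝ) → ℝ → ℝ} {F : ℝ → ℝ} {C : ℝ}

lemma metricFC_eq_radialTensor {p : Cn n} (hp : 0 < radial p) :
    metricFC n I F C p = radialTensor n F (fun t => (coeffE n I F C t - F t) / t) p :=
  radialTensor_eq_blocks hp (coeffE n I F C) F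

lemma IsProfile.hasDerivAt (hF : IsProfile α β F) {t : ℝ} (ht : t ∈ radialInterval α β) :
    HasDerivAt F (deriv F t) t :=
  (((contDiffOn_infty_iff_deriv_of_isOpen (isOpen_radialInterval α β)).1
    hF.smooth).1.differentiableAt ((isOpen_radialInterval α β).mem_nhds ht)).hasDerivAt

lemma IsProfile.coeffE_eq (hF : IsProfile α β F) {t : ℝ} (ht : t ∈ radialInterval α β) :
    coeffE n I F C t = F t + t * deriv F t - 2 / (t ^ (n - 1) * F t ^ (n - 2)) * (I F t + C)⁻¹ := by
  have h := ((hasDerivAt_id t).fun_mul (hF.hasDerivAt ht)).deriv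
  simp only [id, one_mul] at h
  rw [coeffE, h]

/-- The derivative in the admissibility condition is a positive multiple of `coeffE`. -/
lemma deriv_admissible (hn : 2 ≤ n) (hα : 0 ≤ α) (hI : IsAntiderivativeChoice n α β I)
    (hF : IsProfile α β F) {t : ℝ} (ht : t ∈ radialInterval α β) (hC : I F t + C ≠ 0) :
    deriv (fun s => s * F s * (((I F s + C) / (2 * n - 1)) ^ 2)⁻¹) t =
      ((2 * n - 1) / (I F t + C)) ^ 2 * coeffE n I F C t := by
  have ht0 := pos_of_mem_radialInterval hα ht
  have hF0 := hF.pos t ht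
  have hn' : (2 * n - 1 : ℝ) ≠ 0 := by
    have : (2 : ℝ) ≤ n := by exact_mod_cast hn
    linarith
  have h1 := (hasDerivAt_id t).fun_mul (hF.hasDerivAt ht)
  have h2 := (((hI.hasDerivAt F hF t ht).add_const C).div_const (2 * n - 1 : ℝ)).fun_pow 2
  have h3 := h1.fun_mul (h2.fun_inv (pow_ne_zero 2 (div_ne_zero hC hn')))
  refine h3.deriv.trans ?_
  rw [hF.coeffE_eq ht]
  obtain ⟨m, rfl⟩ : ∃ m, n = m + 2 := ⟨n - 2, by omega⟩
  simp only [id, show m + 2 - 1 = m + 1 from rfl, Nat.add_sub_cancel]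
  push_cast at hn' ⊢
  field_simp
  ring

lemma contDiffOn_antiderivative (hα : 0 ≤ α) (hI : IsAntiderivativeChoice n α β I)
    (hF : IsProfile α β F) : ContDiffOn ℝ ∞ (I F) (radialInterval α β) := by
  refine (contDiffOn_infty_iff_deriv_of_isOpen (isOpen_radialInterval α β)).2
    ⟨fun t ht => (hI.hasDerivAt F hF t ht).differentiableAt.differentiableWithinAt, ?_⟩
  have h : ContDiffOn ℝ ∞ (fun t => 1 / (t ^ n * F t ^ (n - 1))) (radialInterval α β) :=
    contDiffOn_const.div ((contDiffOn_id.pow n).mul (hF.smooth.pow (n - 1))) fun t ht =>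
      (mul_pos (pow_pos (pos_of_mem_radialInterval hα ht) _) (pow_pos (hF.pos t ht) _)).ne'
  exact h.congr fun t ht => (hI.hasDerivAt F hF t ht).deriv

lemma IsAdmissible.contDiffOn_coeffE (hα : 0 ≤ α) (hI : IsAntiderivativeChoice n α β I)
    (hA : IsAdmissible n α β I F C) : ContDiffOn ℝ ∞ (coeffE n I F C) (radialInterval α β) := by
  have hF := hA.profile
  have hd : ContDiffOn ℝ ∞ (deriv F) (radialInterval α β) :=
    ((contDiffOn_infty_iff_deriv_of_isOpen (isOpen_radialInterval α β)).1 hF.smooth).2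
  have h : ContDiffOn ℝ ∞ (fun t => F t + t * deriv F t
      - 2 / (t ^ (n - 1) * F t ^ (n - 2)) * (I F t + C)⁻¹) (radialInterval α β) :=
    (hF.smooth.add (contDiffOn_id.mul hd)).sub ((contDiffOn_const.div
      ((contDiffOn_id.pow (n - 1)).mul (hF.smooth.pow (n - 2))) fun t ht =>
      (mul_pos (pow_pos (pos_of_mem_radialInterval hα ht) _) (pow_pos (hF.pos t ht) _)).ne').mul
      (((contDiffOn_antiderivative hα hI hF).add contDiffOn_const).inv hA.ne_zero))
  exact h.congr fun t ht => hF.coeffE_eq ht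

lemma IsAdmissible.coeffE_pos (hn : 2 ≤ n) (hα : 0 ≤ α) (hI : IsAntiderivativeChoice n α β I)
    (hA : IsAdmissible n α β I F C) {t : ℝ} (ht : t ∈ radialInterval α β) :
    0 < coeffE n I F C t := by
  have h := hA.increasing t ht
  rw [deriv_admissible hn hα hI hA.profile ht (hA.ne_zero t ht)] at h
  exact pos_of_mul_pos_right h (sq_nonneg _)

lemma IsAdmissible.isRadialData (hn : 2 ≤ n) (hα : 0 ≤ α) (hI : IsAntiderivativeChoice n α β I)
    (hA : IsAdmissible n α β I F C) {k : ℝ → ℝ}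
    (hk : k = fun t => (coeffE n I F C t - F t) / t) :
    ContDiffOn ℝ ∞ k (radialInterval α β) ∧ (∀ t ∈ radialInterval α β, 0 < F t + k t * t) ∧
    IsRadialData (radialInterval α β) F k (deriv F) (deriv k) (deriv (deriv F))
      (deriv (deriv k)) := by
  have hk' : ContDiffOn ℝ ∞ k (radialInterval α β) := by
    rw [hk]
    exact ((hA.contDiffOn_coeffE hα hI).sub hA.profile.smooth).div contDiffOn_id fun t ht =>
      (pos_of_mem_radialInterval hα ht).ne'
  have hE : ∀ t ∈ radialInterval α β, 0 < F t + k t * t := fun t ht => by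
    have h0 := pos_of_mem_radialInterval hα ht
    have h1 : F t + k t * t = coeffE n I F C t := by
      rw [hk]
      field_simp
      ring
    rw [h1]
    exact hA.coeffE_pos hn hα hI ht
  exact ⟨hk', hE, isRadialData_of_contDiffOn (isOpen_radialInterval α β) hA.profile.smooth hk'
    hA.profile.pos hE⟩

/-- The torsion function of `g_{(F, C)}` is `2 (∫ d𝐳 / (𝐳ⁿ Fⁿ⁻¹) + C)⁻¹`. -/
lemma IsProfile.torsion_eq (hn : 2 ≤ n) (hα : 0 ≤ α) (hF : IsProfile α β F) {t : ℝ}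
    (ht : t ∈ radialInterval α β) :
    torsion n F (fun t => (coeffE n I F C t - F t) / t) t = 2 * (I F t + C)⁻¹ := by
  have ht0 := pos_of_mem_radialInterval hα ht
  have hF0 := hF.pos t ht
  obtain ⟨m, rfl⟩ : ∃ m, n = m + 2 := ⟨n - 2, by omega⟩
  rw [torsion, hF.coeffE_eq ht]
  simp only [show m + 2 - 1 = m + 1 from rfl, Nat.add_sub_cancel]
  field_simp
  ring

/-- If `f' ≠ k` somewhere then `dω(p, e_j, √-1 e_j) ≠ 0` at a point `p` on the axis of `e_i`. -/
lemma not_isKahlerOn_of_torsion {S : Set ℝ} {f k f₁ k₁ f₂ k₂ : ℝ → ℝ} {g : TensorField n}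
    (hD : IsRadialData S f k f₁ k₁ f₂ k₂) (hg : ∀ p, radial p ∈ S → g p = radialTensor n f k p)
    {i j : Fin n} (hij : i ≠ j) {t : ℝ} (ht : t ∈ S) (ht0 : 0 < t) (hd : f₁ t - k t ≠ 0) :
    ¬ IsKahlerOn {p : Cn n | radial p ∈ S} g := by
  intro hK
  have hrad := radial_sqrt_smul_single i ht0.le
  have h := hK (√t • EuclideanSpace.single i (1 : ℂ)) (by change radial _ ∈ S; rwa [hrad])
    (√t • EuclideanSpace.single i (1 : ℂ)) (EuclideanSpace.single j 1)
    (Complex.I • EuclideanSpace.single j (1 : ℂ))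
  have e1 : inner ℝ (√t • EuclideanSpace.single i (1 : ℂ)) (EuclideanSpace.single j (1 : ℂ))
      = 0 := by
    simp [real_inner_eq_re, hij, EuclideanSpace.inner_single_left, ← Complex.coe_smul]
  have e2 : inner ℝ (√t • EuclideanSpace.single i (1 : ℂ))
      (Complex.I • EuclideanSpace.single j (1 : ℂ)) = 0 := by
    simp [real_inner_eq_re, hij, EuclideanSpace.inner_single_left, ← Complex.coe_smul]
  have e3 : inner ℝ (EuclideanSpace.single j (1 : ℂ)) (EuclideanSpace.single j (1 : ℂ))
      = (1 : ℝ) := by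
    simp
  rw [dAssocForm_eq hD hg (by rw [hrad]; exact ht), e1, e2, inner_I_smul_I_smul, e3,
    ← radial_eq_inner, hrad] at h
  have : 2 * (f₁ t - k t) * t = 0 := by linarith
  exact mul_ne_zero (mul_ne_zero two_ne_zero hd) ht0.ne' this

lemma IsAdmissible.isModuliMetric (hn : 2 ≤ n) (hα : 0 ≤ α) (hαβ : (α : EReal) < β)
    (hI : IsAntiderivativeChoice n α β I) (hA : IsAdmissible n α β I F C) :
    IsModuliMetric n α β (metricFC n I F C) := by
  set k : ℝ → ℝ := fun t => (coeffE n I F C t - F t) / t with hk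
  obtain ⟨hks, hE, hD⟩ := hA.isRadialData hn hα hI hk
  have hF := hA.profile
  have hg : ∀ p : Cn n, radial p ∈ radialInterval α β → metricFC n I F C p = radialTensor n F k p :=
    fun p hp => metricFC_eq_radialTensor (pos_of_mem_radialInterval hα hp)
  have htor : ∀ t ∈ radialInterval α β, torsion n F k t = 2 * (I F t + C)⁻¹ :=
    fun t ht => hF.torsion_eq hn hα ht
  refine ⟨isHermitianMetricOn_radialTensor hF.smooth hks hF.pos hE hg,
    isUnitaryInvariantOn_radialTensor hg, ?_, fun p hp => ?_⟩
  · obtain ⟨t, ht⟩ := radialInterval_nonempty hαβ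
    have ht0 := pos_of_mem_radialInterval hα ht
    refine not_isKahlerOn_of_torsion hD hg (i := ⟨0, by omega⟩) (j := ⟨1, by omega⟩) (by simp)
      ht ht0 ((torsion_ne_zero_iff (n := n) hD ht ht0.ne').1 ?_)
    rw [htor t ht]
    exact mul_ne_zero two_ne_zero (inv_ne_zero (hA.ne_zero t ht))
  · have hp0 := pos_of_mem_radialInterval hα hp
    refine (klsc_iff_torsion hn hD hg hp hp0).2 ?_
    have hF0 := hF.pos _ hp
    have hC := hA.ne_zero _ hp
    have h1 := (((hI.hasDerivAt F hF _ hp).add_const C).fun_inv hC).const_mul 2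
    have h2 : torsion n F k =ᶠ[nhds (radial p)] fun t => 2 * (I F t + C)⁻¹ :=
      Filter.eventuallyEq_of_mem ((isOpen_radialInterval α β).mem_nhds hp) htor
    rw [h2.deriv_eq, h1.deriv, htor _ hp]
    field_simp

lemma lineCoeff_pos (hα : 0 ≤ α) {g : TensorField n} (hH : IsHermitianMetricOn (annulus n α β) g)
    (i : Fin n) {t : ℝ} (ht : t ∈ radialInterval α β) : 0 < lineCoeff g i t :=
  hH.pos _ (sqrt_smul_single_mem_annulus hα i ht) _ (by simp)

lemma orthCoeff_pos (hα : 0 ≤ α) {g : TensorField n} (hH : IsHermitianMetricOn (annulus n α β) g)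
    (i j : Fin n) {t : ℝ} (ht : t ∈ radialInterval α β) : 0 < orthCoeff g i j t :=
  hH.pos _ (sqrt_smul_single_mem_annulus hα i ht) _ (by simp)

/-- Every metric in the moduli space comes from an admissible pair. -/
lemma IsModuliMetric.exists_isAdmissible (hn : 2 ≤ n) (hα : 0 ≤ α)
    (hI : IsAntiderivativeChoice n α β I) {g : TensorField n} (hM : IsModuliMetric n α β g) :
    ∃ (F : ℝ → ℝ) (C : ℝ), IsAdmissible n α β I F C ∧
      Set.EqOn g (metricFC n I F C) (annulus n α β) := by
  have hH := hM.hermitianMetric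
  obtain ⟨i, j, hij⟩ : ∃ i j : Fin n, i ≠ j := ⟨⟨0, by omega⟩, ⟨1, by omega⟩, by simp⟩
  set S := radialInterval α β with hS
  have hSo : IsOpen S := isOpen_radialInterval α β
  set F := orthCoeff g i j with hFdef
  set E := lineCoeff g i with hEdef
  set k : ℝ → ℝ := fun t => (E t - F t) / t with hk
  have hg : ∀ p : Cn n, radial p ∈ S → g p = radialTensor n F k p :=
    fun p hp => eq_radialTensor_of_invariant hα hH hM.invariant hij hp
  have hF : IsProfile α β F := ⟨contDiffOn_apply_sqrt_smul_single hα hH.smooth i _,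
    fun t ht => orthCoeff_pos hα hH i j ht⟩
  have hEs : ContDiffOn ℝ ∞ E S := contDiffOn_apply_sqrt_smul_single hα hH.smooth i _
  have hkt : ∀ t ∈ S, F t + k t * t = E t := fun t ht => by
    have := pos_of_mem_radialInterval hα ht
    rw [hk]
    field_simp
    ring
  have hks : ContDiffOn ℝ ∞ k S := (hEs.sub hF.smooth).div contDiffOn_id fun t ht =>
    (pos_of_mem_radialInterval hα ht).ne'
  have hD := isRadialData_of_contDiffOn hSo hF.smooth hks hF.pos fun t ht => by
    rw [hkt t ht]
    exact lineCoeff_pos hα hH i ht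
  set u := torsion n F k with hu
  have hode : ∀ t ∈ S, 2 * t ^ n * F t ^ (n - 1) * deriv u t = -u t ^ 2 := fun t ht => by
    have ht0 := pos_of_mem_radialInterval hα ht
    have hr := radial_sqrt_smul_single i ht0.le
    have h := (klsc_iff_torsion hn hD hg (p := √t • EuclideanSpace.single i (1 : ℂ))
      (by rwa [hr]) (by rwa [hr])).1 (hM.klsc _ (sqrt_smul_single_mem_annulus hα i ht))
    rwa [hr] at h
  have ha0 : ∀ t ∈ S, 2 * t ^ n * F t ^ (n - 1) ≠ 0 := fun t ht =>
    mul_ne_zero (mul_ne_zero two_ne_zero (pow_ne_zero _ (pos_of_mem_radialInterval hα ht).ne'))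
      (pow_ne_zero _ (hF.pos t ht).ne')
  have hu0 : ∀ t ∈ S, u t ≠ 0 := by
    intro t₀ ht₀ hut₀
    refine hM.nonKahler fun p hp v w x => ?_
    have hp0 := pos_of_mem_radialInterval hα hp
    have hzero : u (radial p) = 0 := eq_zero_of_bernoulli hSo (ordConnected_radialInterval α β)
      ((continuousOn_const.mul (continuousOn_id.pow n)).mul (hF.smooth.continuousOn.pow (n - 1)))
      ha0 (fun t ht => differentiableAt_torsion hD ht) hode ht₀ hut₀ hp
    have hd : deriv F (radial p) - k (radial p) = 0 := by
      by_contra h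
      exact (torsion_ne_zero_iff hD hp hp0.ne').2 h hzero
    rw [dAssocForm_eq hD hg hp, hd, mul_zero, zero_mul]
  -- `2 / u` has the same derivative as the chosen antiderivative
  have hder : ∀ t ∈ S, HasDerivAt (fun t => 2 / u t - I F t) 0 t := fun t ht => by
    have h1 := ((hasDerivAt_const t (2 : ℝ)).fun_div
      (differentiableAt_torsion hD ht).hasDerivAt (hu0 t ht)).fun_sub (hI.hasDerivAt F hF t ht)
    refine h1.congr_deriv ?_
    have h2 := hode t ht
    have h3 := ha0 t ht
    have h4 := hu0 t ht
    have h5 : deriv u t = -u t ^ 2 / (2 * t ^ n * F t ^ (n - 1)) := by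
      rw [eq_div_iff h3, ← h2]
      ring
    have h6 := (pos_of_mem_radialInterval hα ht).ne'
    have h7 := (hF.pos t ht).ne'
    rw [← hu, h5]
    field_simp
    ring
  obtain ⟨C, hC⟩ := hSo.exists_is_const_of_deriv_eq_zero
    (ordConnected_radialInterval α β).isPreconnected
    (fun t ht => (hder t ht).differentiableAt.differentiableWithinAt) fun t ht => (hder t ht).deriv
  have hC' : ∀ t ∈ S, I F t + C = 2 / u t := fun t ht => by rw [← hC t ht]; ring
  have hne : ∀ t ∈ S, I F t + C ≠ 0 := fun t ht => by
    rw [hC' t ht]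
    exact div_ne_zero two_ne_zero (hu0 t ht)
  have hcoeff : ∀ t ∈ S, coeffE n I F C t = E t := fun t ht => by
    have ht0 := pos_of_mem_radialInterval hα ht
    have hF0 := hF.pos t ht
    rw [hF.coeffE_eq ht, hC' t ht, inv_div, ← hkt t ht, hu, torsion]
    obtain ⟨m, rfl⟩ : ∃ m, n = m + 2 := ⟨n - 2, by omega⟩
    simp only [show m + 2 - 1 = m + 1 from rfl, Nat.add_sub_cancel]
    field_simp
    ring
  refine ⟨F, C, ⟨hF, hne, fun t ht => ?_⟩, fun p hp => ?_⟩
  · rw [deriv_admissible hn hα hI hF ht (hne t ht), hcoeff t ht]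
    have hn' : (2 * n - 1 : ℝ) ≠ 0 := by
      have : (2 : ℝ) ≤ n := by exact_mod_cast hn
      linarith
    have := div_ne_zero hn' (hne t ht)
    exact mul_pos (by positivity) (lineCoeff_pos hα hH i ht)
  · have hp0 := pos_of_mem_radialInterval hα hp
    rw [hg p hp, metricFC_eq_radialTensor hp0]
    simp only [radialTensor, hk, hcoeff _ hp]

/-- The profile and the constant are determined by the metric: the profile is the coefficient
orthogonal to the complex line through the base point, and the coefficient along that line then
determines the constant. -/
lemma metricFC_injective (hn : 2 ≤ n) (hα : 0 ≤ α) (hαβ : (α : EReal) < β)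
    (hI : IsAntiderivativeChoice n α β I) {F' : ℝ → ℝ} {C' : ℝ} (hA : IsAdmissible n α β I F C)
    (hA' : IsAdmissible n α β I F' C')
    (h : Set.EqOn (metricFC n I F C) (metricFC n I F' C') (annulus n α β)) :
    Set.EqOn F' F (radialInterval α β) ∧ C' = C := by
  obtain ⟨i, j, hij⟩ : ∃ i j : Fin n, i ≠ j := ⟨⟨0, by omega⟩, ⟨1, by omega⟩, by simp⟩
  have hval (F : ℝ → ℝ) (C : ℝ) {t : ℝ} (ht : t ∈ radialInterval α β) :
      orthCoeff (metricFC n I F C) i j t = F t ∧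
        lineCoeff (metricFC n I F C) i t = coeffE n I F C t := by
    have ht0 := pos_of_mem_radialInterval hα ht
    have hr := radial_sqrt_smul_single i ht0.le
    rw [orthCoeff, lineCoeff, metricFC_eq_radialTensor (by rwa [hr]), radialTensor_apply,
      radialTensor_apply, hr]
    constructor
    · simp [real_inner_eq_re, hij, EuclideanSpace.inner_single_left, ← Complex.coe_smul]
    · simp [real_inner_eq_re, ← Complex.coe_smul]
      rw [Real.mul_self_sqrt ht0.le]
      field_simp
      ring
  have hcoef {t : ℝ} (ht : t ∈ radialInterval α β) :
      F' t = F t ∧ coeffE n I F' C' t = coeffE n I F C t := by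
    have hpt := h (sqrt_smul_single_mem_annulus hα i ht)
    rw [← (hval F C ht).1, ← (hval F' C' ht).1, ← (hval F C ht).2, ← (hval F' C' ht).2]
    simp only [orthCoeff, lineCoeff, hpt, and_self]
  have hFF : Set.EqOn F' F (radialInterval α β) := fun t ht => (hcoef ht).1
  refine ⟨hFF, ?_⟩
  obtain ⟨t, ht⟩ := radialInterval_nonempty hαβ
  have ht0 := pos_of_mem_radialInterval hα ht
  have hF0 := hA.profile.pos t ht
  have hd : deriv F' t = deriv F t :=
    (Filter.eventuallyEq_of_mem ((isOpen_radialInterval α β).mem_nhds ht) hFF).deriv_eq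
  have hE := (hcoef ht).2
  rw [hA.profile.coeffE_eq ht, hA'.profile.coeffE_eq ht, hd, hFF ht,
    hI.congr F' F hA'.profile hA.profile hFF ht] at hE
  have hc : 2 / (t ^ (n - 1) * F t ^ (n - 2)) ≠ 0 := by positivity
  have := inv_injective (mul_left_cancel₀ hc (sub_right_injective hE))
  linarith

end Moduli

end Klsc

end

theorem theorem2 (n : ℕ) (hn : 2 ≤ n) (α : ℝ) (hα : 0 ≤ α) (β : EReal) (hαβ : (α : EReal) < β)
    (I : (ℝ → ℝ) → ℝ → ℝ) (hI : Klsc.IsAntiderivativeChoice n α β I) :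
    -- every admissible pair gives a metric of the required kind
    (∀ (F : ℝ → ℝ) (C : ℝ), Klsc.IsAdmissible n α β I F C →
      Klsc.IsModuliMetric n α β (Klsc.metricFC n I F C)) ∧
    -- every metric of the required kind comes from an admissible pair, which is unique
    (∀ g : Klsc.TensorField n, Klsc.IsModuliMetric n α β g →
      ∃ (F : ℝ → ℝ) (C : ℝ), Klsc.IsAdmissible n α β I F C ∧
        Set.EqOn g (Klsc.metricFC n I F C) (Klsc.annulus n α β) ∧
        ∀ (F' : ℝ → ℝ) (C' : ℝ), Klsc.IsAdmissible n α β I F' C' →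
          Set.EqOn g (Klsc.metricFC n I F' C') (Klsc.annulus n α β) →
          Set.EqOn F' F (Klsc.radialInterval α β) ∧ C' = C) := by
  refine ⟨fun F C hA => hA.isModuliMetric hn hα hαβ hI, fun g hg => ?_⟩
  obtain ⟨F, C, hA, hgF⟩ := hg.exists_isAdmissible hn hα hI
  exact ⟨F, C, hA, hgF, fun F' C' hA' hgF' =>
    Klsc.metricFC_injective hn hα hαβ hI hA hA' (hgF.symm.trans hgF')⟩
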